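/- **Setting.** Let $A_\bullet^n(z)=\dfrac{(\sqrt3-n)z+n}{-nz+n+\sqrt3}$ (for $n\in\mathbb N$ this is the $n$-th iterate of $A_\bullet(z)=\frac{(\sqrt3-1)z+1}{-z+\sqrt3+1}$; the formula is used for all complex $n$) and $f_n^{\pm}(z)=A_\bullet\bigl(e^{\pm2\pi i/3}A_\bullet^n(z)\bigr)$, $\overline{f}{}_n^{\pm}(z)=\overline{f_{\bar n}^{\pm}(\bar z)}$. With $S(x,y)=\bigl(\tfrac{x+1}4,\tfrac y4\bigr)$ put $$\widehat G_n^\pm(x,y)=\Bigl(\tfrac12\bigl(f_n^\pm(x+iy)+\overline{f}{}_n^\pm(x-iy)\bigr),\ \tfrac1{2i}\bigl(f_n^\pm(x+iy)-\overline{f}{}_n^\pm(x-iy)\bigr)\Bigr),\qquad G_n^\pm=S^{-1}\widehat G_n^\pm S,$$ and $J_n^\pm=\bigl(\sqrt{(f_n^\pm)'(x+iy)\,(\overline{f}{}_n^\pm)'(x-iy)}\bigr)\circ S$, where the root is the branch positive for real $n\ge0$ and $(x,y)\in[-1,1]^2$, continued analytically (it is a rational function of $n,x,y$). Powers $w^s$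 are principal. For $r>0$ let $\mathcal E_r^{2,2}=\cos\bigl(\mathbb R^2+i\{t\in\mathbb R^2:\|t\|_2<r\}\bigr)\subset\mathbb C^2$ (cosine taken coordinatewise), and let $\mathcal H_r^{2,2}$ be the space of functions that are analytic on $\mathcal E_r^{2,2}$, continuous on its closure and real on $[-1,1]^2$, with norm $\|\varphi\|=\sup_{\mathcal E_r^{2,2}}|\varphi|$. Let $r_A=0.9$, $\nu_A=10$. The Apollonian transfer operator is $$(\mathcal A_s\varphi)(x,y)=\sum_{n=0}^\infty\sum_\pm J_n^\pm(x,y)^s\,\varphi(G_n^\pm(x,y)).$$ For $N,L,M,M'\in\mathbb N$, with $\tau_N=(N-\nu_A)/e$ and $B_{k}$ the Bernoulli numbers, put $$z_m=N+\tau_Ne^{2\pi i\frac{2m-1}{2M}},\qquad c_m=-\sum_{l=1}^L\frac{B_{2l}}{2l}\,\tau_N^{-(2l-1)}e^{-2\pi i\frac{(2l-1)(2m-1)}{2M}}\qquad(1\le m\le M),$$ and, for $0\le m<M'$, $$\zeta_m=Ne^{-\pi i\frac{2m+1}{M'}},\qquad \gamma_m(s)=N^{1-2s}\sum_{p=0}^{M'-1}\frac{e^{-\pi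 i p\frac{2m+1}{M'}}}{p+2s-1}.$$ **Theorem.** There are a constant $C_A>0$ and functions $N,L,M,M'$ of $\varepsilon>0$ with values in $\mathbb N$, all of them $O(\log\varepsilon)$ as $\varepsilon\to0^+$, such that for every $\varepsilon>0$ we have $N>\nu_A$, $L\ge1$, $M\ge2L$, $M'\ge1$, $2L<2e\pi(N-\nu_A)$, and the following holds. For every real $s>\frac12$ there are complex numbers $c'_m$ and $z'_m$ with $|z'_m|\ge N$ $(0\le m<M')$, depending on $\varepsilon$ and $s$ only, such that for all $\varphi\in\mathcal H^{2,2}_{r_A}$ and all $(x,y)\in[-1,1]^2$ the series $(\mathcal A_s\varphi)(x,y)$ converges absolutely and $$\Bigl|(\mathcal A_s\varphi)(x,y)-\sum_\pm\Bigl(\sum_{n=0}^{N-1}J_n^\pm(x,y)^s\varphi(G_n^\pm(x,y))+\tfrac12J_N^\pm(x,y)^s\varphi(G_N^\pm(x,y))+\frac1M\sum_{m=1}^Mc_mJ_{z_m}^\pm(x,y)^s\varphi(G_{z_m}^\pm(x,y))$$ $$\qquad+\frac1{M'}\sum_{m=0}^{M'-1}c'_m\bigl((z'_m)^2J_{z'_m}^\pm(x,y)\bigr)^s\varphi(G_{z'_m}^\pm(x,y))\Bigr)\Bigr|\le\|\varphi\|\,C_A^s\,\varepsilon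 .$$ Moreover, whenever $2s-1\ge\varepsilon$, the choice is the explicit one: $z'_m=\zeta_m$ and $c'_m=\gamma_m(s)$. -/

import Mathlib

open Filter Topology Asymptotics
open scoped ComplexConjugate

namespace Apollonian

noncomputable section

/-! ### The induced iterated function system -/

/-- The parabolic Moebius map `A_•`. -/
def parabolicMap (z : ℂ) : ℂ :=
  (((√3 : ℝ) - 1) * z + 1) / (-z + (√3 : ℝ) + 1)

/-- The number `e^{± 2πi/3}`; the sign `±` is an element of `ℤˣ = {1, -1}`. -/
def rot (σ : ℤˣ) : ℂ :=
  Complex.exp (2 * Real.pi * Complex.I / 3 * ((σ : ℤ) : ℂ))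

/-- Numerator of `f_n^±(z)`. -/
def num (σ : ℤˣ) (n z : ℂ) : ℂ :=
  ((√3 : ℝ) - 1) * (rot σ * (((√3 : ℝ) - n) * z + n)) + (-n * z + n + (√3 : ℝ))

/-- Denominator of `f_n^±(z)`. -/
def den (σ : ℤˣ) (n z : ℂ) : ℂ :=
  -(rot σ * (((√3 : ℝ) - n) * z + n)) + ((√3 : ℝ) + 1) * (-n * z + n + (√3 : ℝ))

/-- The Moebius map `f_n^± = A_• ∘ e^{±2πi/3} ∘ A_•^n`, for an arbitrary complex `n`, where
`A_•^n z = ((√3 - n) z + n) / (-n z + n + √3)`. See `f_eq_iterate` for natural `n`. -/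
def f (σ : ℤˣ) (n z : ℂ) : ℂ := num σ n z / den σ n z

/-- The conjugate map `z ↦ conj (f_n (conj z))`, extended analytically from real to complex `n`. -/
def fBar (σ : ℤˣ) (n z : ℂ) : ℂ := conj (f σ (conj n) (conj z))

/-- The complex number `x + iy` for `(x, y) = S(z₁, z₂)`, where `S(z) = (z + 1) / 4`, that is,
`S(z₁, z₂) = ((z₁ + 1) / 4, z₂ / 4)`. -/
def wPlus (z : ℂ × ℂ) : ℂ := (z.1 + 1) / 4 + Complex.I * (z.2 / 4)

/-- The complex number `x - iy` for `(x, y) = S(z₁, z₂)`. -/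
def wMinus (z : ℂ × ℂ) : ℂ := (z.1 + 1) / 4 - Complex.I * (z.2 / 4)

/-- `G_n^± = S⁻¹ ∘ Ĝ_n^± ∘ S` on `ℂ²`, with
`Ĝ_n^±(x, y) = ((f(x+iy) + fBar(x-iy)) / 2, (f(x+iy) - fBar(x-iy)) / (2i))` and
`S⁻¹(u, v) = (4u - 1, 4v)`. -/
def G (σ : ℤˣ) (n : ℂ) (z : ℂ × ℂ) : ℂ × ℂ :=
  (4 * ((f σ n (wPlus z) + fBar σ n (wMinus z)) / 2) - 1,
   4 * ((f σ n (wPlus z) - fBar σ n (wMinus z)) / (2 * Complex.I)))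

/-- The Jacobian `J_n^± = √(f_n'(x+iy) · fBar_n'(x-iy)) ∘ S`. Since `f_n'(w) = 9 e^{±2πi/3} / den²`,
the radicand is a square, and the branch of the root which is positive for real arguments is the
rational function below; see `J_sq` and `J_real`. -/
def J (σ : ℤˣ) (n : ℂ) (z : ℂ × ℂ) : ℂ :=
  9 / (den σ n (wPlus z) * conj (den σ (conj n) (conj (wMinus z))))

theorem sqrt_three_sq : ((√3 : ℝ) : ℂ) ^ 2 = 3 := by
  rw [← Complex.ofReal_pow, Real.sq_sqrt (by norm_num)]; norm_num

theorem iterate_den_ne_zero (n : ℕ) {z : ℂ} (hz : ‖z‖ ≤ 1) :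
    -(n : ℂ) * z + n + (√3 : ℝ) ≠ 0 := by
  intro h
  have h1 := congrArg Complex.re h
  simp at h1
  have h2 : z.re ≤ 1 := (Complex.re_le_norm z).trans hz
  have h3 : (0 : ℝ) < √3 := by positivity
  nlinarith [mul_le_mul_of_nonneg_left h2 (Nat.cast_nonneg (α := ℝ) n)]

theorem parabolicMap_div (p r : ℂ) (hr : r ≠ 0) :
    parabolicMap (p / r) =
      (((√3 : ℝ) - 1) * p + r) / (-p + ((√3 : ℝ) + 1) * r) := by
  have h1 : ((√3 : ℝ) - 1) * (p / r) + 1 = (((√3 : ℝ) - 1) * p + r) / r := by field_simp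
  have h2 : -(p / r) + (√3 : ℝ) + 1 = (-p + ((√3 : ℝ) + 1) * r) / r := by field_simp; ring
  rw [parabolicMap, h1, h2, div_div_div_cancel_right₀ hr]

theorem parabolicMap_iterate (n : ℕ) {z : ℂ} (hz : ‖z‖ ≤ 1) :
    parabolicMap^[n] z = (((√3 : ℝ) - n) * z + n) / (-n * z + n + (√3 : ℝ)) := by
  have h3 : ((√3 : ℝ) : ℂ) ≠ 0 := by
    intro h
    have := sqrt_three_sq
    rw [h] at this
    norm_num at this
  induction n with
  | zero => simp [h3]
  | succ k ih =>
    rw [Function.iterate_succ_apply', ih, parabolicMap_div _ _ (iterate_den_ne_zero k hz),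
      ← mul_div_mul_left _ (-((k + 1 : ℕ) : ℂ) * z + (k + 1 : ℕ) + (√3 : ℝ)) h3]
    congr 1
    · push_cast; linear_combination (z - z * 1) * sqrt_three_sq
    · push_cast; linear_combination (0 : ℂ) * sqrt_three_sq

/-- For natural `n`, the map `f_n^±` is the composition that defines the induced system. -/
theorem f_eq_iterate (σ : ℤˣ) (n : ℕ) {z : ℂ} (hz : ‖z‖ ≤ 1) :
    f σ n z = parabolicMap (rot σ * parabolicMap^[n] z) := by
  rw [parabolicMap_iterate n hz, ← mul_div_assoc,
    parabolicMap_div _ _ (iterate_den_ne_zero n hz)]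
  rfl

theorem hasDerivAt_f (σ : ℤˣ) (n z : ℂ) (h : den σ n z ≠ 0) :
    HasDerivAt (f σ n) (9 * rot σ / den σ n z ^ 2) z := by
  have h1 : HasDerivAt (num σ n) (((√3 : ℝ) - 1) * (rot σ * ((√3 : ℝ) - n)) + -n) z := by
    have := (((((hasDerivAt_id z).const_mul (((√3 : ℝ) : ℂ) - n)).add_const n).const_mul
      (rot σ)).const_mul (((√3 : ℝ) : ℂ) - 1)).add
      ((((hasDerivAt_id z).const_mul (-n)).add_const n).add_const ((√3 : ℝ) : ℂ))
    convert this using 1 <;> first | (ext y; simp [num]) | simp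
  have h2 : HasDerivAt (den σ n) (-(rot σ * ((√3 : ℝ) - n)) + ((√3 : ℝ) + 1) * -n) z := by
    have := ((((hasDerivAt_id z).const_mul (((√3 : ℝ) : ℂ) - n)).add_const n).const_mul
      (rot σ)).neg.add
      (((((hasDerivAt_id z).const_mul (-n)).add_const n).add_const ((√3 : ℝ) : ℂ)).const_mul
        (((√3 : ℝ) : ℂ) + 1))
    convert this using 1 <;> first | (ext y; simp [den]) | simp
  have h3 : (((√3 : ℝ) - 1) * (rot σ * ((√3 : ℝ) - n)) + -n) * den σ n z -
      num σ n z * (-(rot σ * ((√3 : ℝ) - n)) + ((√3 : ℝ) + 1) * -n) = 9 * rot σ := by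
    simp only [num, den]
    linear_combination (rot σ * (((√3 : ℝ) : ℂ) ^ 2 + 3)) * sqrt_three_sq
  rw [← h3]
  exact h1.div h2 h

/-- `J` is a square root of the product of derivatives. -/
theorem J_sq (σ : ℤˣ) (n : ℂ) (z : ℂ × ℂ) (h : den σ n (wPlus z) ≠ 0)
    (h' : den σ (conj n) (conj (wMinus z)) ≠ 0) :
    J σ n z ^ 2 = deriv (f σ n) (wPlus z) * deriv (fBar σ n) (wMinus z) := by
  have h1 := (hasDerivAt_f σ n _ h).deriv
  have h2 : HasDerivAt (fBar σ n)
      (conj (9 * rot σ / den σ (conj n) (conj (wMinus z)) ^ 2)) (wMinus z) := by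
    have := (hasDerivAt_f σ (conj n) _ h').conj_conj
    rw [Complex.conj_conj] at this
    exact this
  have h4 : rot σ * conj (rot σ) = 1 := by
    rw [rot, ← Complex.exp_conj, ← Complex.exp_add]
    have h6 : 2 * Real.pi * Complex.I / 3 * ((σ : ℤ) : ℂ) +
        conj (2 * Real.pi * Complex.I / 3 * ((σ : ℤ) : ℂ)) = 0 := by
      simp only [map_mul, map_div₀, map_ofNat, Complex.conj_ofReal, Complex.conj_I, map_intCast]
      ring
    rw [h6, Complex.exp_zero]
  have h5 : conj (den σ (conj n) (conj (wMinus z))) ≠ 0 := by simpa using h'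
  rw [h1, h2.deriv, J]
  simp only [map_div₀, map_mul, map_pow, map_ofNat]
  field_simp
  linear_combination (-1) * h4

/-- For real `n`, `x`, `y` the function `J` is real and nonnegative. -/
theorem J_real (σ : ℤˣ) (n x y : ℝ) :
    J σ n ((x : ℂ), (y : ℂ)) = ((9 / ‖den σ n (wPlus ((x : ℂ), (y : ℂ)))‖ ^ 2 : ℝ) : ℂ) := by
  have h : conj (wMinus ((x : ℂ), (y : ℂ))) = wPlus ((x : ℂ), (y : ℂ)) := by
    have h4 : (starRingEnd ℂ) 4 = 4 := map_ofNat _ 4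
    simp [wMinus, wPlus, h4, Complex.conj_ofReal]
  rw [J, h, Complex.conj_ofReal, Complex.mul_conj']
  push_cast
  rfl

/-- For real `n`, `x`, `y` the map `G_n^±` is `f_n^±` read in real coordinates and
conjugated by `S`. -/
theorem G_real (σ : ℤˣ) (n x y : ℝ) :
    G σ n ((x : ℂ), (y : ℂ)) =
      (((4 * (f σ n (wPlus ((x : ℂ), (y : ℂ)))).re - 1 : ℝ) : ℂ),
       ((4 * (f σ n (wPlus ((x : ℂ), (y : ℂ)))).im : ℝ) : ℂ)) := by
  have h : conj (wMinus ((x : ℂ), (y : ℂ))) = wPlus ((x : ℂ), (y : ℂ)) := by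
    have h4 : (starRingEnd ℂ) 4 = 4 := map_ofNat _ 4
    simp [wMinus, wPlus, h4, Complex.conj_ofReal]
  rw [G, fBar, h, Complex.conj_ofReal, Complex.add_conj, Complex.sub_conj]
  have hI := Complex.I_ne_zero
  ext1
  · push_cast; ring
  · push_cast; field_simp

/-! ### Hardy spaces -/

/-- The two-dimensional Bernstein ellipse `cos(ℝ² + i {t ∈ ℝ² | ‖t‖₂ < r})`. -/
def bernstein (r : ℝ) : Set (ℂ × ℂ) :=
  {z | ∃ a b t u : ℝ, t ^ 2 + u ^ 2 < r ^ 2 ∧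
    z = (Complex.cos (a + Complex.I * t), Complex.cos (b + Complex.I * u))}

/-- Membership in the Hardy space `H_r^{2,2}`: analytic on the Bernstein ellipse, continuous on its
closure, and real-valued on the square `[-1, 1]²`. -/
structure MemHardy (r : ℝ) (φ : ℂ × ℂ → ℂ) : Prop where
  analytic : AnalyticOnNhd ℂ φ (bernstein r)
  continuousOn : ContinuousOn φ (closure (bernstein r))
  real : ∀ x ∈ Set.Icc (-1 : ℝ) 1, ∀ y ∈ Set.Icc (-1 : ℝ) 1, (φ ((x : ℂ), (y : ℂ))).im = 0

/-- The supremum norm on the Bernstein ellipse. -/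
def hardyNorm (r : ℝ) (φ : ℂ × ℂ → ℂ) : ℝ := ⨆ z : bernstein r, ‖φ z‖

/-- The radius `r_A`. -/
def rA : ℝ := 9 / 10

/-- The radius of analyticity `ν_A`. -/
def nuA : ℝ := 10

/-! ### The transfer operator -/

/-- The `n`-th term `∑_± J_n^±(z)^s φ(G_n^±(z))` of the transfer operator. -/
def transferTerm (s : ℝ) (φ : ℂ × ℂ → ℂ) (z : ℂ × ℂ) (n : ℂ) : ℂ :=
  ∑ σ : ℤˣ, J σ n z ^ (s : ℂ) * φ (G σ n z)

/-- The Apollonian transfer operator `A_s`. -/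
def transferOp (s : ℝ) (φ : ℂ × ℂ → ℂ) (z : ℂ × ℂ) : ℂ :=
  ∑' n : ℕ, transferTerm s φ z n

/-! ### Nodes and weights -/

/-- The radius `τ_N = (N - ν_A) / e`. -/
def tau (N : ℕ) : ℝ := (N - nuA) / Real.exp 1

/-- The nodes `z_m`, `1 ≤ m ≤ M`, on the circle of radius `τ_N` about `N`. -/
def derivNode (N M m : ℕ) : ℂ :=
  N + tau N * Complex.exp (2 * Real.pi * Complex.I * ((2 * m - 1) / (2 * M)))

/-- The weights `c_m`, `1 ≤ m ≤ M`. -/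
def derivWeight (N L M m : ℕ) : ℂ :=
  -∑ l ∈ Finset.Icc 1 L, (bernoulli (2 * l) : ℂ) / (2 * l) * ((tau N : ℂ) ^ (2 * l - 1))⁻¹ *
    Complex.exp (-(2 * Real.pi * Complex.I * ((2 * l - 1) * (2 * m - 1) / (2 * M))))

/-- The nodes `z'_m`, `0 ≤ m < M'`, on the circle of radius `N` about `0`. -/
def integralNode (N M' m : ℕ) : ℂ :=
  N * Complex.exp (-(Real.pi * Complex.I * ((2 * m + 1) / M')))

/-- The weights `c'_m`, `0 ≤ m < M'`, for the exponent `s`. -/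
def integralWeight (s : ℝ) (N M' m : ℕ) : ℂ :=
  (((N : ℝ) ^ (1 - 2 * s) : ℝ) : ℂ) * ∑ p ∈ Finset.range M',
    Complex.exp (-(Real.pi * Complex.I * (p * (2 * m + 1) / M'))) / (p + 2 * s - 1)

end

end Apollonian

namespace Apollonian

/-! Fix a real point and a sign. As a function of n, the Moebius map f_n(w) has a single simple
pole, so `f_eq` writes it as a limit plus `res σ / (n + pole σ w)` with |pole| ≤ 5, and J_n = c /
((n + p)(n + conj p)). Hence the summand is a function h(n) that is holomorphic and bounded by 7^s
‖φ‖ on Re n > 24. On the real axis it equals t^(-2s) g(1/t), with g holomorphic and equally bounded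
on |u| < 1/24. The geometric input is `gPath_mem`: for |n| > 24 the points G_n stay within 1/9, in
each coordinate, of a point of the real square, and hence inside the Bernstein ellipse.

The first N terms are summed exactly. On the tail, Euler-Maclaurin (`norm_em_tail_le`) leaves half
of h(N), the integral of h over (N, ∞), and odd derivatives of h at N. Its remainder decays
geometrically in L because h is bounded on discs whose radius grows linearly with the center.

Both remaining objects are read off from Taylor coefficients, which averages over scaled M-th roots
of -1 recover up to aliasing (`norm_circle_average_sub_le`). For the derivatives the circle is
centered at N (`norm_deriv_sum_le`). For the integral, g is expanded in u = 1/t, each power is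
integrated in closed form, and the coefficients of g are recovered from a circle |n| = R
(`norm_integral_sub_quadrature_le`).

Every error is O(7^s ‖φ‖ 2^(-L)) when N, M, M' are suitable affine functions of L, and L is of order
|log ε|. The one danger is the factor 1 / (2s - 1) in the integrated powers. It is harmless for R =
N when 2s - 1 ≥ ε; otherwise R is enlarged until the aliasing error absorbs it (`exists_radius`). -/

/-! ### Bernoulli polynomials and Euler-Maclaurin on finite intervals. -/

open Set MeasureTheory Nat in
theorem abs_bernoulliFun_le (k : ℕ) {x : ℝ} (hx : x ∈ Icc (0 : ℝ) 1) :
    |bernoulliFun k x| ≤ k ! := by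
  induction k generalizing x with
  | zero => simp
  | succ k ih =>
    -- Rolle for B_(k+2), whose endpoint values agree, gives a zero of B_(k+1); the mean value
    -- inequality from that zero then costs only the factor k + 1.
    obtain ⟨c, hc, hc0⟩ : ∃ c ∈ Ioo (0 : ℝ) 1, deriv (bernoulliFun (k + 2)) c = 0 :=
      exists_deriv_eq_zero one_pos (continuous_bernoulliFun _).continuousOn
        (bernoulliFun_endpoints_eq_of_ne_one (by omega)).symm
    have hc1 : bernoulliFun (k + 1) c = 0 := by
      have h2 : ((k : ℝ) + 2) ≠ 0 := by positivity
      simpa [h2] using hc0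
    have key := (convex_Icc (0 : ℝ) 1).norm_image_sub_le_of_norm_hasDerivWithin_le
      (f := bernoulliFun (k + 1)) (f' := fun t => ((k + 1 : ℕ) : ℝ) * bernoulliFun k t)
      (C := (k + 1)!) (fun t _ => (hasDerivAt_bernoulliFun (k + 1) t).hasDerivWithinAt)
      (fun t ht => by
        rw [Nat.factorial_succ, norm_mul, Real.norm_natCast, Nat.cast_mul, Real.norm_eq_abs]
        gcongr
        exact ih ht) (Ioo_subset_Icc_self hc) hx
    rw [hc1, sub_zero, Real.norm_eq_abs] at key
    refine key.trans (mul_le_of_le_one_right (by positivity) ?_)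
    rw [Real.norm_eq_abs, abs_le]
    constructor <;> linarith [hx.1, hx.2, hc.1, hc.2]

open Set in
theorem hasDerivAt_iteratedDeriv {h : ℂ → ℂ} {U : Set ℂ} (hU : IsOpen U)
    (hh : DifferentiableOn ℂ h U) (k : ℕ) {z : ℂ} (hz : z ∈ U) :
    HasDerivAt (iteratedDeriv k h) (iteratedDeriv (k + 1) h z) z := by
  rw [iteratedDeriv_succ]
  have h1 : AnalyticAt ℂ h z := hh.analyticAt (hU.mem_nhds hz)
  have h2 : AnalyticAt ℂ (iteratedDeriv k h) z := by
    rw [iteratedDeriv_eq_iterate]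
    exact h1.iterated_deriv k
  exact h2.differentiableAt.hasDerivAt

/-- The normalized Bernoulli polynomial `B_k(x) / k!`. -/
noncomputable def bern (k : ℕ) (x : ℝ) : ℝ := bernoulliFun k x / k.factorial

/-- The `k`-th Euler-Maclaurin remainder on the interval `[a, a + 1]`. -/
noncomputable def emRem (h : ℂ → ℂ) (k : ℕ) (a : ℝ) : ℂ :=
  ∫ x in (0 : ℝ)..1, (bern k x : ℂ) * iteratedDeriv k h ((a + x : ℝ) : ℂ)

theorem hasDerivAt_bern (k : ℕ) (x : ℝ) : HasDerivAt (bern (k + 1)) (bern k x) x := by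
  have h : HasDerivAt (bern (k + 1)) _ x :=
    (hasDerivAt_bernoulliFun (k + 1) x).div_const ((k + 1).factorial : ℝ)
  refine h.congr_deriv ?_
  rw [bern, Nat.factorial_succ, Nat.add_sub_cancel]
  push_cast
  field_simp

theorem continuous_bern (k : ℕ) : Continuous (bern k) :=
  (continuous_bernoulliFun k).div_const _

theorem abs_bern_le (k : ℕ) {x : ℝ} (hx : x ∈ Set.Icc (0 : ℝ) 1) : |bern k x| ≤ 1 := by
  rw [bern, abs_div, Nat.abs_cast, div_le_one (by positivity)]
  exact abs_bernoulliFun_le k hx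

-- Integration by parts: the normalized Bernoulli polynomials are successive primitives of one
-- another.
open Set in
theorem emRem_step {h : ℂ → ℂ} {U : Set ℂ} (hU : IsOpen U) (hh : DifferentiableOn ℂ h U)
    (k : ℕ) {a : ℝ} (ha : ∀ x ∈ Icc (0 : ℝ) 1, ((a + x : ℝ) : ℂ) ∈ U) :
    emRem h k a = bern (k + 1) 1 * iteratedDeriv k h ((a + 1 : ℝ) : ℂ) -
      bern (k + 1) 0 * iteratedDeriv k h (a : ℂ) - emRem h (k + 1) a := by
  have hI : uIcc (0 : ℝ) 1 = Icc 0 1 := uIcc_of_le zero_le_one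
  have hD : ∀ j : ℕ, ∀ x ∈ Icc (0 : ℝ) 1,
      HasDerivAt (fun x : ℝ => iteratedDeriv j h ((a + x : ℝ) : ℂ))
        (iteratedDeriv (j + 1) h ((a + x : ℝ) : ℂ)) x := by
    intro j x hx
    have h1 := hasDerivAt_iteratedDeriv hU hh j (ha x hx)
    have h2 := h1.comp_ofReal
    simpa using h2.comp_const_add a x
  have hc : ∀ j : ℕ, ContinuousOn (fun x : ℝ => iteratedDeriv j h ((a + x : ℝ) : ℂ)) (uIcc 0 1) :=
    fun j x hx => ((hD j x (hI ▸ hx)).continuousAt).continuousWithinAt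
  have hb : ∀ j, Continuous fun x : ℝ => (bern j x : ℂ) :=
    fun j => Complex.continuous_ofReal.comp (continuous_bern j)
  have key := intervalIntegral.integral_deriv_mul_eq_sub (a := 0) (b := 1)
    (u := fun x : ℝ => (bern (k + 1) x : ℂ)) (u' := fun x : ℝ => (bern k x : ℂ))
    (v := fun x : ℝ => iteratedDeriv k h ((a + x : ℝ) : ℂ))
    (v' := fun x : ℝ => iteratedDeriv (k + 1) h ((a + x : ℝ) : ℂ))
    (fun x _ => (hasDerivAt_bern k x).ofReal_comp) (fun x hx => hD k x (hI ▸ hx))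
    ((hb k).intervalIntegrable _ _) ((hc (k + 1)).intervalIntegrable)
  rw [intervalIntegral.integral_add] at key
  · simp only [emRem]
    simp only [add_zero] at key
    rw [← key]
    ring
  · exact ((hb k).continuousOn.mul (hc k)).intervalIntegrable
  · exact ((hb _).continuousOn.mul (hc _)).intervalIntegrable

theorem bern_one_eq {k : ℕ} (hk : k ≠ 1) : bern k 1 = bern k 0 := by
  rw [bern, bern, bernoulliFun_endpoints_eq_of_ne_one hk]

theorem bern_zero_eq (k : ℕ) : bern k 0 = bernoulli k / k.factorial := by
  rw [bern, bernoulliFun_eval_zero]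

/-- The Euler-Maclaurin formula on an interval of length one. -/
theorem em_unit {h : ℂ → ℂ} {U : Set ℂ} (hU : IsOpen U) (hh : DifferentiableOn ℂ h U)
    (L : ℕ) {a : ℝ} (ha : ∀ x ∈ Set.Icc (0 : ℝ) 1, ((a + x : ℝ) : ℂ) ∈ U) :
    ∫ t in a..(a + 1), h (t : ℂ) = 1 / 2 * (h a + h ((a + 1 : ℝ) : ℂ)) -
      (∑ l ∈ Finset.Icc 1 L, (bern (2 * l) 0 : ℂ) *
        (iteratedDeriv (2 * l - 1) h ((a + 1 : ℝ) : ℂ) - iteratedDeriv (2 * l - 1) h (a : ℂ))) -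
      emRem h (2 * L + 1) a := by
  induction L with
  | zero =>
    have h0 : emRem h 0 a = ∫ t in a..(a + 1), h (t : ℂ) := by
      simp only [emRem, bern, bernoulliFun_zero, iteratedDeriv_zero, Nat.factorial_zero,
        Nat.cast_one, div_one, Complex.ofReal_one, one_mul]
      rw [intervalIntegral.integral_comp_add_left (fun t : ℝ => h (t : ℂ)) a, add_zero]
    -- B_1 is ±1/2 at the two endpoints, which produces the trapezoidal half sum.
    rw [← h0, emRem_step hU hh 0 ha]
    simp [bern]
    ring
  | succ L ih =>
    rw [ih, emRem_step hU hh (2 * L + 1) ha, emRem_step hU hh (2 * L + 1 + 1) ha,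
      Finset.sum_Icc_succ_top (by omega), bern_one_eq (by omega), bern_one_eq (by omega)]
    -- Each increment of L is two integrations by parts; the boundary terms of the second one carry
    -- an odd Bernoulli number and vanish.
    have hodd : bern (2 * L + 1 + 1 + 1) 0 = 0 := by
      rw [bern_zero_eq, bernoulli_eq_zero_of_odd ⟨L + 1, by ring⟩ (by omega)]
      simp
    rw [hodd, show 2 * (L + 1) = 2 * L + 1 + 1 by ring, Nat.add_sub_cancel]
    push_cast
    ring

theorem em_finite {h : ℂ → ℂ} {U : Set ℂ} (hU : IsOpen U) (hh : DifferentiableOn ℂ h U)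
    (L : ℕ) {N : ℕ} (hN : ∀ x : ℝ, N ≤ x → (x : ℂ) ∈ U) (P : ℕ) :
    ∫ t in (N : ℝ)..(N + P : ℕ), h (t : ℂ) =
      ∑ i ∈ Finset.range P, h ((N + i : ℕ) : ℂ) + 1 / 2 * (h ((N + P : ℕ) : ℂ) - h (N : ℂ)) -
      (∑ l ∈ Finset.Icc 1 L, (bern (2 * l) 0 : ℂ) *
        (iteratedDeriv (2 * l - 1) h ((N + P : ℕ) : ℂ) - iteratedDeriv (2 * l - 1) h (N : ℂ))) -
      ∑ i ∈ Finset.range P, emRem h (2 * L + 1) ((N + i : ℕ) : ℝ) := by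
  have hcont : ContinuousOn (fun t : ℝ => h (t : ℂ)) (Set.Ici (N : ℝ)) := fun t ht =>
    ((hh.differentiableAt (hU.mem_nhds (hN t ht))).continuousAt.comp
      Complex.continuous_ofReal.continuousAt).continuousWithinAt
  have hint : ∀ P Q : ℕ, IntervalIntegrable (fun t : ℝ => h (t : ℂ)) MeasureTheory.volume
      ((N + P : ℕ) : ℝ) ((N + Q : ℕ) : ℝ) := fun P Q => by
    refine (hcont.mono fun t ht => ?_).intervalIntegrable
    have h1 : (N : ℝ) ≤ ((N + P : ℕ) : ℝ) := by push_cast; linarith [(P.cast_nonneg : (0:ℝ) ≤ P)]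
    have h2 : (N : ℝ) ≤ ((N + Q : ℕ) : ℝ) := by push_cast; linarith [(Q.cast_nonneg : (0:ℝ) ≤ Q)]
    exact (le_inf h1 h2).trans ht.1
  induction P with
  | zero => simp
  | succ P ih =>
    have h0 := hint 0 P
    rw [add_zero] at h0
    rw [← intervalIntegral.integral_add_adjacent_intervals h0 (hint P (P + 1)), ih,
      Finset.sum_range_succ, Finset.sum_range_succ]
    have := em_unit hU hh L (a := ((N + P : ℕ) : ℝ)) (fun x hx => hN _ (by
      push_cast; linarith [(P.cast_nonneg : (0:ℝ) ≤ P), hx.1]))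
    have hc : ((N + (P + 1) : ℕ) : ℝ) = ((N + P : ℕ) : ℝ) + 1 := by push_cast; ring
    have hc' : ((N + (P + 1) : ℕ) : ℂ) = ((((N + P : ℕ) : ℝ) + 1 : ℝ) : ℂ) := by push_cast; ring
    rw [hc, this, hc', Complex.ofReal_natCast]
    simp only [mul_sub, Finset.sum_sub_distrib, mul_add]
    ring

/-! ### Taylor coefficients from averages over circles. -/

open Complex Finset in
/-- Averaging against the `M` nodes `exp (π i (2m + 1) / M)` extracts the `k`-th Taylor
coefficient up to aliasing. -/
theorem norm_circle_average_sub_le {a : ℕ → ℂ} {F : ℂ → ℂ} {S x r : ℝ} (hr : 0 ≤ r)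
    (hF : ∀ z : ℂ, ‖z‖ = r → HasSum (fun q => a q * z ^ q) (F z))
    (ha : ∀ q, ‖a q‖ * r ^ q ≤ S * x ^ q) (hx0 : 0 ≤ x) (hx1 : x < 1) {k M : ℕ} (hk : k < M) :
    ‖1 / (M : ℂ) * ∑ m ∈ range M, exp (-(Real.pi * I * (k * (2 * m + 1) / M))) *
        F (r * exp (Real.pi * I * ((2 * m + 1) / M))) - a k * r ^ k‖ ≤
      S * (x ^ M / (1 - x)) := by
  have hM : (M : ℂ) ≠ 0 := Nat.cast_ne_zero.2 (by omega)
  set e : ℕ → ℂ := fun m => exp (Real.pi * I * ((2 * m + 1) / M)) with he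
  have hee : ∀ m, e m = exp (((Real.pi * ((2 * m + 1) / M) : ℝ) : ℂ) * I) := fun m => by
    simp only [he]; congr 1; push_cast; ring
  have hen : ∀ m, ‖e m‖ = 1 := fun m => by rw [hee, norm_exp_ofReal_mul_I]
  have hinv : ∀ m : ℕ, exp (-(Real.pi * I * (k * (2 * m + 1) / M))) = (e m ^ k)⁻¹ := fun m => by
    simp only [he]; rw [← exp_nat_mul, ← exp_neg]; congr 1; ring
  simp only [hinv]
  set c : ℕ → ℂ := fun q => 1 / (M : ℂ) * ∑ m ∈ range M, (e m ^ k)⁻¹ * e m ^ q with hc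
  have hcn : ∀ q, ‖c q‖ ≤ 1 := fun q => by
    rw [hc, norm_mul, norm_div, norm_one, norm_natCast]
    have h1 : ‖∑ m ∈ range M, (e m ^ k)⁻¹ * e m ^ q‖ ≤ M := by
      refine (norm_sum_le _ _).trans ?_
      simp [hen]
    have h2 : (0 : ℝ) < M := Nat.cast_pos.2 (by omega)
    rw [one_div, inv_mul_le_iff₀ h2, mul_one]
    exact h1
  have hck : c k = 1 := by
    have h1 : ∀ m, (e m ^ k)⁻¹ * e m ^ k = 1 := fun m =>
      inv_mul_cancel₀ (pow_ne_zero _ (exp_ne_zero _))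
    simp only [hc, h1]
    simp [hM]
  -- Orthogonality: the half-step shift of the nodes only contributes a constant factor, and what
  -- remains is a full geometric sum of a nontrivial M-th root of unity.
  have hc0 : ∀ q < M, q ≠ k → c q = 0 := fun q hq hqk => by
    have hω := isPrimitiveRoot_exp M (by omega)
    set ω := exp (2 * Real.pi * I / M) with hωd
    have hω0 : ω ≠ 0 := exp_ne_zero _
    have he' : ∀ m : ℕ, e m = exp (Real.pi * I / M) * ω ^ m := fun m => by
      rw [hωd, ← exp_nat_mul, ← exp_add]; simp only [he]; congr 1; field_simp; ring
    set v := (ω ^ k)⁻¹ * ω ^ q with hv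
    have hv1 : v ≠ 1 := fun h => by
      rw [hv, inv_mul_eq_one₀ (pow_ne_zero _ hω0)] at h
      exact hqk (hω.pow_inj hk hq h).symm
    have hvM : v ^ M = 1 := by
      rw [hv, mul_pow, inv_pow, ← pow_mul, ← pow_mul, mul_comm k, mul_comm q, pow_mul, pow_mul,
        hω.pow_eq_one]; simp
    have hg : ∑ m ∈ range M, v ^ m = 0 := by
      have := mul_geom_sum v M
      rw [hvM, sub_self] at this
      exact (mul_eq_zero.1 this).resolve_left (sub_ne_zero.2 hv1)
    have ht : ∀ m, (e m ^ k)⁻¹ * e m ^ q =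
        ((exp (Real.pi * I / M)) ^ k)⁻¹ * exp (Real.pi * I / M) ^ q * v ^ m := fun m => by
      rw [he', hv, mul_pow, mul_pow, mul_pow, mul_inv, inv_pow, ← pow_mul, ← pow_mul, ← pow_mul,
        ← pow_mul, mul_comm m k, mul_comm m q]
      ring
    simp only [hc, ht, ← Finset.mul_sum, hg, mul_zero]
  have hs1 : HasSum (fun q => a q * r ^ q * c q)
      (1 / (M : ℂ) * ∑ m ∈ range M, (e m ^ k)⁻¹ * F (r * e m)) := by
    have h1 : ∀ m ∈ range M, HasSum (fun q => (e m ^ k)⁻¹ * (a q * (r * e m) ^ q))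
        ((e m ^ k)⁻¹ * F (r * e m)) := fun m _ =>
      (hF (r * e m) (by rw [norm_mul, hen, mul_one, norm_real, Real.norm_of_nonneg hr])).mul_left _
    have h2 : (fun q => a q * r ^ q * c q) = fun q =>
        1 / (M : ℂ) * ∑ m ∈ range M, (e m ^ k)⁻¹ * (a q * (r * e m) ^ q) := by
      funext q
      rw [mul_left_comm, Finset.mul_sum]
      congr 1
      exact Finset.sum_congr rfl fun m _ => by rw [mul_pow]; ring
    rw [h2]
    exact (hasSum_sum h1).mul_left (1 / (M : ℂ))
  have hs2 : HasSum (fun q => if q = k then a k * (r : ℂ) ^ k else 0) (a k * r ^ k) :=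
    hasSum_ite_eq k _
  have hs3 := hs1.sub hs2
  have hs4 : HasSum (fun q => S * (x ^ M * x ^ q)) (S * (x ^ M * (1 - x)⁻¹)) :=
    ((hasSum_geometric_of_lt_one hx0 hx1).mul_left _).mul_left _
  have hz : ∑ q ∈ range M, (a q * r ^ q * c q - if q = k then a k * (r : ℂ) ^ k else 0) = 0 := by
    refine Finset.sum_eq_zero fun q hq => ?_
    by_cases hqk : q = k
    · rw [if_pos hqk, hqk, hck, mul_one, sub_self]
    · rw [if_neg hqk, hc0 q (Finset.mem_range.1 hq) hqk, mul_zero, sub_zero]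
  rw [← hasSum_nat_add_iff' M, hz, sub_zero] at hs3
  rw [div_eq_mul_inv]
  -- Only the frequencies q ≥ M remain, each with weight at most 1; they are bounded by a geometric
  -- series.
  refine hs3.norm_le_of_bounded hs4 fun q => ?_
  rw [if_neg (by omega), sub_zero, norm_mul, norm_mul, norm_pow, norm_real,
    Real.norm_of_nonneg hr, ← pow_add, add_comm M q]
  exact (mul_le_of_le_one_right (by positivity) (hcn _)).trans (ha _)

open Metric in
/-- Taylor series of a bounded analytic function on a disc, with Cauchy's bounds. -/
theorem hasSum_taylor {F : ℂ → ℂ} {U : Set ℂ} {c : ℂ} {R S : ℝ} (hR : 0 < R)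
    (hF : DifferentiableOn ℂ F U) (hU : closedBall c R ⊆ U) (hS : ∀ z ∈ U, ‖F z‖ ≤ S) :
    (∀ k, ‖iteratedDeriv k F c / k.factorial‖ * R ^ k ≤ S) ∧
    ∀ z : ℂ, ‖z‖ < R → HasSum (fun k => iteratedDeriv k F c / k.factorial * z ^ k) (F (c + z)) := by
  constructor
  · intro k
    have h1 : DiffContOnCl ℂ F (ball c R) :=
      (hF.mono (closure_ball_subset_closedBall.trans hU)).diffContOnCl
    have h2 := Complex.norm_iteratedDeriv_le_of_forall_mem_sphere_norm_le k hR h1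
      (fun z hz => hS z (hU (sphere_subset_closedBall hz)))
    rw [norm_div, Complex.norm_natCast, div_mul_eq_mul_div, div_le_iff₀ (by positivity)]
    rw [le_div_iff₀ (by positivity)] at h2
    linarith
  · intro z hz
    have := Complex.hasSum_taylorSeries_on_ball (c := c) (r := R)
      (hF.mono (ball_subset_closedBall.trans hU)) (z := c + z) (by simpa using hz)
    refine (funext fun k => ?_ : (fun k => _) = _) ▸ this
    rw [smul_eq_mul, smul_eq_mul, add_sub_cancel_left]
    ring

/-! ### Euler-Maclaurin on a half line. -/

/-- Telescoping majorant, used to add up the remainders of all unit intervals uniformly in their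
number. -/
theorem sum_range_inv_sq_le {J : ℝ} (hJ : 2 ≤ J) (P : ℕ) :
    ∑ i ∈ Finset.range P, 1 / (J + i) ^ 2 ≤ 1 / (J - 1) - 1 / (J + P - 1) := by
  induction P with
  | zero => simp
  | succ P ih =>
    rw [Finset.sum_range_succ]
    have hP : (0 : ℝ) ≤ P := P.cast_nonneg
    have h1 : 1 / (J + P) ^ 2 ≤ 1 / (J + P - 1) - 1 / (J + P) := by
      rw [div_sub_div _ _ (by linarith) (by linarith), div_le_div_iff₀ (by nlinarith) (by nlinarith)]
      nlinarith
    push_cast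
    rw [show J + (P + 1) - 1 = J + (P : ℝ) by ring]
    linarith

theorem norm_emRem_le {h : ℂ → ℂ} {k : ℕ} {a C : ℝ}
    (hC : ∀ t : ℝ, a ≤ t → ‖iteratedDeriv k h t‖ ≤ C) : ‖emRem h k a‖ ≤ C := by
  have := intervalIntegral.norm_integral_le_of_norm_le_const (a := (0 : ℝ)) (b := 1) (C := C)
    (f := fun x : ℝ => (bern k x : ℂ) * iteratedDeriv k h ((a + x : ℝ) : ℂ)) (fun x hx => by
      rw [Set.uIoc_of_le zero_le_one] at hx
      rw [norm_mul, Complex.norm_real, Real.norm_eq_abs]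
      exact (mul_le_of_le_one_left (norm_nonneg _) (abs_bern_le k ⟨hx.1.le, hx.2⟩)).trans
        (hC _ (by linarith [hx.1])))
  rw [emRem]
  simpa using this

open MeasureTheory in
/-- The Euler-Maclaurin formula on a half line for a bounded analytic function whose radius of
convergence grows linearly. -/
theorem norm_em_tail_le {h : ℂ → ℂ} {U : Set ℂ} (hU : IsOpen U) (hh : DifferentiableOn ℂ h U)
    {S : ℝ} (hS : ∀ z ∈ U, ‖h z‖ ≤ S) {L N : ℕ} (hL : 1 ≤ L) (hN : N = 10 + 64 * L)
    (hball : ∀ t : ℝ, N ≤ t → Metric.closedBall (t : ℂ) ((t - 10) / 2) ⊆ U)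
    (hsum : Summable fun i : ℕ => h ((N + i : ℕ) : ℂ))
    (hint : IntegrableOn (fun t : ℝ => h t) (Set.Ioi (N : ℝ))) :
    ‖∑' i : ℕ, h ((N + i : ℕ) : ℂ) - (1 / 2 * h N + ∫ t in Set.Ioi (N : ℝ), h (t : ℂ)) +
      ∑ l ∈ Finset.Icc 1 L, (bern (2 * l) 0 : ℂ) * iteratedDeriv (2 * l - 1) h N‖ ≤
      288 * S * (1 / 16) ^ L := by
  have hN' : (N : ℝ) = 10 + 64 * L := by rw [hN]; push_cast; ring
  have hL' : (1 : ℝ) ≤ L := by exact_mod_cast hL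
  have hmem : ∀ t : ℝ, N ≤ t → (t : ℂ) ∈ U := fun t ht =>
    hball t ht (Metric.mem_closedBall_self (by linarith))
  have hS0 : 0 ≤ S := (norm_nonneg _).trans (hS _ (hmem N le_rfl))
  -- Cauchy's estimate on the disc of radius (t - 10) / 2, half of the distance from t to 10.
  have hD : ∀ k, ∀ t : ℝ, N ≤ t → ‖iteratedDeriv k h t‖ ≤ S * k.factorial * (2 / (t - 10)) ^ k := by
    intro k t ht
    have ht10 : 0 < t - 10 := by linarith
    have h1 := (hasSum_taylor (by positivity) hh (hball t ht) hS).1 k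
    rw [norm_div, Complex.norm_natCast, div_mul_eq_mul_div, div_le_iff₀ (by positivity)] at h1
    rw [div_pow, ← mul_div_assoc, le_div_iff₀ (by positivity)]
    rw [div_pow, ← mul_div_assoc, div_le_iff₀ (by positivity)] at h1
    exact h1
  have hR : ∀ i : ℕ, ‖emRem h (2 * L + 1) ((N + i : ℕ) : ℝ)‖ ≤
      288 * S * (1 / 16) ^ L * (1 / ((64 * L : ℝ) + i) ^ 2) := by
    intro i
    have hi : (0 : ℝ) ≤ i := i.cast_nonneg
    set j : ℝ := 64 * L + i with hj
    clear_value j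
    have hj64 : 64 * (L : ℝ) ≤ j := by linarith
    have hj0 : 0 < j := by linarith
    refine norm_emRem_le fun t ht => ?_
    have ht' : j ≤ t - 10 := by push_cast at ht; linarith
    refine (hD _ t (by push_cast at ht; linarith)).trans ?_
    have hf : ((2 * L + 1).factorial : ℝ) ≤ (3 * L) ^ (2 * L + 1) := by
      have h1 : (2 * L + 1).factorial ≤ (3 * L) ^ (2 * L + 1) :=
        (Nat.factorial_le_pow _).trans (Nat.pow_le_pow_left (by omega) _)
      exact_mod_cast h1
    have h2 : (2 / (t - 10)) ^ (2 * L + 1) ≤ (2 / j) ^ (2 * L + 1) := by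
      have : 0 < t - 10 := by linarith
      gcongr
    -- Two of the 2L + 1 factors are kept as 1 / j², to be summed over the intervals; the others are
    -- at most 1/8 each because j ≥ 64L. The constant is 288 = 8 · 36.
    have h3 : (3 * L) ^ (2 * L + 1) * (2 / j) ^ (2 * L + 1) = (6 * L / j) ^ (2 * L - 1) *
        (36 * L ^ 2 * (1 / j ^ 2)) := by
      rw [← mul_pow, show 2 * L + 1 = 2 * L - 1 + 2 by omega, pow_add]
      rw [show 3 * (L : ℝ) * (2 / j) = 6 * L / j by ring]
      congr 1
      ring
    have h4 : (6 * L / j) ^ (2 * L - 1) ≤ (1 / 8 : ℝ) ^ (2 * L - 1) := by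
      refine pow_le_pow_left₀ (by positivity) ?_ _
      rw [div_le_div_iff₀ hj0 (by norm_num)]
      linarith
    have h5 : (1 / 8 : ℝ) ^ (2 * L - 1) = 8 * (1 / 64) ^ L := by
      have : (1 / 8 : ℝ) ^ (2 * L - 1) * (1 / 8) = (1 / 64) ^ L := by
        rw [← pow_succ, show 2 * L - 1 + 1 = 2 * L by omega, pow_mul]; norm_num
      linarith
    have h6 : (L : ℝ) ^ 2 * (1 / 64) ^ L ≤ (1 / 16) ^ L := by
      have h7 : (L : ℝ) ≤ 2 ^ L := by exact_mod_cast L.lt_two_pow_self.le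
      calc (L : ℝ) ^ 2 * (1 / 64) ^ L ≤ (2 ^ L) ^ 2 * (1 / 64) ^ L := by gcongr
        _ = (1 / 16) ^ L := by rw [← pow_mul, mul_comm, mul_comm L 2, pow_mul, ← mul_pow]; norm_num
    calc S * ((2 * L + 1).factorial : ℝ) * (2 / (t - 10)) ^ (2 * L + 1)
        ≤ S * (3 * L) ^ (2 * L + 1) * (2 / j) ^ (2 * L + 1) := by
          gcongr
          exact pow_nonneg (div_nonneg zero_le_two (by linarith)) _
      _ = S * ((6 * L / j) ^ (2 * L - 1) * (36 * L ^ 2 * (1 / j ^ 2))) := by rw [← h3]; ring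
      _ ≤ S * ((1 / 8 : ℝ) ^ (2 * L - 1) * (36 * L ^ 2 * (1 / j ^ 2))) := by gcongr
      _ = 288 * S * (L ^ 2 * (1 / 64) ^ L) * (1 / j ^ 2) := by rw [h5]; ring
      _ ≤ _ := by gcongr
  have hRs : ∀ P : ℕ, ‖∑ i ∈ Finset.range P, emRem h (2 * L + 1) ((N + i : ℕ) : ℝ)‖ ≤
      288 * S * (1 / 16) ^ L := by
    intro P
    refine (norm_sum_le_of_le _ fun i _ => hR i).trans ?_
    rw [← Finset.mul_sum]
    refine mul_le_of_le_one_right (by positivity) ((sum_range_inv_sq_le (by linarith) P).trans ?_)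
    have h1 : 1 / (64 * (L : ℝ) - 1) ≤ 1 := by
      rw [div_le_one (by linarith)]; linarith
    have h2 : 0 ≤ 1 / (64 * (L : ℝ) + P - 1) := by
      apply div_nonneg zero_le_one
      linarith [(P.cast_nonneg : (0 : ℝ) ≤ P)]
    linarith
  have hatTop : Tendsto (fun P : ℕ => ((N + P : ℕ) : ℝ)) atTop atTop :=
    tendsto_natCast_atTop_atTop.comp (tendsto_add_atTop_nat N |>.congr fun _ => add_comm _ _)
  have hD0 : ∀ l ∈ Finset.Icc 1 L, Tendsto
      (fun P : ℕ => iteratedDeriv (2 * l - 1) h ((N + P : ℕ) : ℂ)) atTop (𝓝 0) := by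
    intro l hl
    have hl1 := (Finset.mem_Icc.1 hl).1
    have h1 : Tendsto (fun P : ℕ => S * (2 * l - 1).factorial *
        (2 / (((N + P : ℕ) : ℝ) - 10)) ^ (2 * l - 1)) atTop (𝓝 0) := by
      have h2 : Tendsto (fun P : ℕ => 2 / (((N + P : ℕ) : ℝ) - 10)) atTop (𝓝 0) :=
        (tendsto_atTop_add_const_right _ (-10) hatTop).const_div_atTop 2
      have h3 := (h2.pow (2 * l - 1)).const_mul (S * (2 * l - 1).factorial)
      rwa [zero_pow (by omega), mul_zero] at h3
    refine squeeze_zero_norm (fun P => ?_) h1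
    have := hD (2 * l - 1) ((N + P : ℕ) : ℝ)
      (by push_cast; linarith [(P.cast_nonneg : (0 : ℝ) ≤ P)])
    rwa [Complex.ofReal_natCast] at this
  have hh0 : Tendsto (fun P : ℕ => h ((N + P : ℕ) : ℂ)) atTop (𝓝 0) := hsum.tendsto_atTop_zero
  have hI := intervalIntegral_tendsto_integral_Ioi (N : ℝ) hint hatTop
  -- The finite formula passes to the limit: the boundary terms at N + P vanish, and the bound on
  -- the accumulated remainders is uniform in P.
  have hT := hsum.hasSum.tendsto_sum_nat
  have hlim := (((hT.add ((hh0.sub_const (h N)).const_mul (1 / 2))).sub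
    (tendsto_finsetSum (Finset.Icc 1 L) fun l hl => ((hD0 l hl).sub_const
      (iteratedDeriv (2 * l - 1) h N)).const_mul (bern (2 * l) 0 : ℂ))).sub hI).norm
  refine le_of_tendsto (hlim.congr' ?_) (Eventually.of_forall hRs) |>.trans' (le_of_eq ?_)
  · refine Eventually.of_forall fun P => ?_
    dsimp only
    rw [em_finite hU hh L hmem P]
    congr 1
    ring
  · congr 1
    simp only [zero_sub, mul_neg, Finset.sum_neg_distrib]
    ring

/-! ### The integral over the half line and its quadrature. -/

-- Termwise integration of t^(-2s-p), which yields N^(1-2s-p) / (p + 2s - 1). The interchange is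
-- legitimate because the integrals of the norms are dominated by a multiple of (25 / N)^p ≤ 2^(-p).
open MeasureTheory Set in
theorem hasSum_integral_series {a : ℕ → ℂ} {g h : ℂ → ℂ} {S s : ℝ} {N : ℕ} (hN : 50 ≤ N)
    (hs : 1 / 2 < s) (ha : ∀ p, ‖a p‖ ≤ S * 25 ^ p)
    (hg : ∀ u : ℂ, ‖u‖ < 1 / 25 → HasSum (fun p => a p * u ^ p) (g u))
    (hh : ∀ t : ℝ, N < t → h t = ((t ^ (-(2 * s)) : ℝ) : ℂ) * g (t : ℂ)⁻¹) :
    HasSum (fun p : ℕ => (((N : ℝ) ^ (1 - 2 * s) : ℝ) : ℂ) * (a p * (N : ℂ)⁻¹ ^ p / (p + 2 * s - 1)))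
      (∫ t in Ioi (N : ℝ), h t) := by
  have hN' : (50 : ℝ) ≤ N := by exact_mod_cast hN
  have hN0 : (0 : ℝ) < N := by linarith
  have hS : 0 ≤ S := by simpa using (norm_nonneg _).trans (ha 0)
  set F : ℕ → ℝ → ℂ := fun p t => a p * ((t ^ (-(2 * s) - p) : ℝ) : ℂ) with hF
  have hp : ∀ p : ℕ, -(2 * s) - p < -1 := fun p => by
    linarith [(p.cast_nonneg : (0 : ℝ) ≤ p)]
  have hI : ∀ p : ℕ, ∫ t in Ioi (N : ℝ), t ^ (-(2 * s) - p) =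
      (N : ℝ) ^ (1 - 2 * s) * ((N : ℝ)⁻¹ ^ p / (p + 2 * s - 1)) := fun p => by
    rw [integral_Ioi_rpow_of_lt (hp p) hN0, show -(2 * s) - (p : ℝ) + 1 = (1 - 2 * s) - p by ring,
      Real.rpow_sub hN0, Real.rpow_natCast, show 1 - 2 * s - (p : ℝ) = -(p + 2 * s - 1) by ring,
      neg_div_neg_eq, inv_pow]
    ring
  have hint : ∀ p, Integrable (F p) (volume.restrict (Ioi (N : ℝ))) := fun p =>
    (Integrable.ofReal (integrableOn_Ioi_rpow_of_lt (hp p) hN0)).const_mul _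
  have hnorm : ∀ p, ∫ t in Ioi (N : ℝ), ‖F p t‖ =
      ‖a p‖ * ((N : ℝ) ^ (1 - 2 * s) * ((N : ℝ)⁻¹ ^ p / (p + 2 * s - 1))) := fun p => by
    rw [← hI, ← integral_const_mul]
    refine setIntegral_congr_fun measurableSet_Ioi fun t ht => ?_
    have ht0 : (0 : ℝ) < t := hN0.trans ht
    simp only [hF]
    rw [norm_mul, Complex.norm_real, Real.norm_of_nonneg (by positivity)]
  have hsum : Summable fun p => ∫ t in Ioi (N : ℝ), ‖F p t‖ := by
    have hgeo : Summable fun p : ℕ => S * (N : ℝ) ^ (1 - 2 * s) / (2 * s - 1) * (25 / (N : ℝ)) ^ p :=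
      (summable_geometric_of_lt_one (by positivity)
        (by rw [div_lt_one hN0]; linarith)).mul_left _
    refine Summable.of_nonneg_of_le (fun p => ?_) (fun p => ?_) hgeo
    · exact integral_nonneg fun t => norm_nonneg _
    · rw [hnorm]
      have h1 : 0 < 2 * s - 1 := by linarith
      have h2 : 2 * s - 1 ≤ (p : ℝ) + 2 * s - 1 := by
        linarith [(p.cast_nonneg : (0 : ℝ) ≤ p)]
      calc ‖a p‖ * ((N : ℝ) ^ (1 - 2 * s) * ((N : ℝ)⁻¹ ^ p / (p + 2 * s - 1)))
          ≤ (S * 25 ^ p) * ((N : ℝ) ^ (1 - 2 * s) * ((N : ℝ)⁻¹ ^ p / (2 * s - 1))) := by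
            have h3 : 0 < (p : ℝ) + 2 * s - 1 := by linarith
            refine mul_le_mul (ha p) ?_ (by positivity) (by positivity)
            gcongr
        _ = _ := by rw [div_eq_mul_inv 25, mul_pow]; ring
  have key := hasSum_integral_of_summable_integral_norm hint hsum
  have hh' : ∫ t in Ioi (N : ℝ), ∑' p, F p t = ∫ t in Ioi (N : ℝ), h t := by
    refine setIntegral_congr_fun measurableSet_Ioi fun t ht => ?_
    have ht0 : (0 : ℝ) < t := hN0.trans ht
    have hu : ‖(t : ℂ)⁻¹‖ < 1 / 25 := by
      rw [norm_inv, Complex.norm_real, Real.norm_of_nonneg ht0.le, ← one_div]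
      exact one_div_lt_one_div_of_lt (by norm_num) (by linarith [mem_Ioi.1 ht])
    rw [hh t ht, ← ((hg _ hu).mul_left _).tsum_eq]
    refine tsum_congr fun p => ?_
    simp only [hF]
    rw [Real.rpow_sub ht0, Real.rpow_natCast]
    push_cast
    rw [inv_pow]
    ring
  rw [hh'] at key
  refine (funext fun p => ?_ : (fun p => _) = _) ▸ key
  simp only [hF]
  rw [integral_const_mul, integral_complex_ofReal, hI]
  push_cast
  ring

/-- The nodes of modulus `R` used to approximate the integral. -/
noncomputable def circNode (R : ℝ) (M m : ℕ) : ℂ :=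
  R * Complex.exp (-(Real.pi * Complex.I * ((2 * m + 1) / M)))

/-- The weights that belong to the nodes `circNode R M`. -/
noncomputable def circWeight (s : ℝ) (N : ℕ) (R : ℝ) (M m : ℕ) : ℂ :=
  (((N : ℝ) ^ (1 - 2 * s) : ℝ) : ℂ) * ∑ p ∈ Finset.range M,
    ((R / N : ℝ) : ℂ) ^ p * Complex.exp (-(Real.pi * Complex.I * (p * (2 * m + 1) / M))) /
      (p + 2 * s - 1)

theorem circNode_natCast (N M m : ℕ) : circNode N M m = integralNode N M m := by
  rw [circNode, integralNode, Complex.ofReal_natCast]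

theorem circWeight_natCast {s : ℝ} {N : ℕ} (hN : N ≠ 0) (M m : ℕ) :
    circWeight s N N M m = integralWeight s N M m := by
  rw [circWeight, integralWeight]
  simp [div_self (Nat.cast_ne_zero.2 hN : (N : ℝ) ≠ 0)]

theorem norm_circNode {R : ℝ} (hR : 0 ≤ R) (M m : ℕ) : ‖circNode R M m‖ = R := by
  have : (-(Real.pi * Complex.I * ((2 * m + 1) / M)) : ℂ) =
      ((-(Real.pi * ((2 * m + 1) / M)) : ℝ) : ℂ) * Complex.I := by push_cast; ring
  rw [circNode, norm_mul, this, Complex.norm_exp_ofReal_mul_I, mul_one, Complex.norm_real,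
    Real.norm_of_nonneg hR]

theorem inv_circNode (R : ℝ) (M m : ℕ) : (circNode R M m)⁻¹ =
    (R⁻¹ : ℝ) * Complex.exp (Real.pi * Complex.I * ((2 * m + 1) / M)) := by
  rw [circNode, mul_inv, ← Complex.exp_neg, neg_neg, Complex.ofReal_inv]

-- The series is cut at p = M, and each a_p kept is replaced by its circle average. The rescaling (R
-- / N)^p amplifies the aliasing error (25 / R)^M to at most (25 / N)^(M-1) · 25 / R, so one factor
-- 1 / R survives; a large R can offset 1 / (2s - 1).
open MeasureTheory Set in
theorem norm_integral_sub_quadrature_le {a : ℕ → ℂ} {g h : ℂ → ℂ} {S s R : ℝ} {N M : ℕ}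
    (hN : 50 ≤ N) (hR : N ≤ R) (hM : 1 ≤ M) (hs : 1 / 2 < s) (ha : ∀ p, ‖a p‖ ≤ S * 25 ^ p)
    (hg : ∀ u : ℂ, ‖u‖ < 1 / 25 → HasSum (fun p => a p * u ^ p) (g u))
    (hh : ∀ t : ℝ, N < t → h t = ((t ^ (-(2 * s)) : ℝ) : ℂ) * g (t : ℂ)⁻¹) :
    ‖(∫ t in Ioi (N : ℝ), h t) - 1 / (M : ℂ) * ∑ m ∈ Finset.range M,
      circWeight s N R M m * g (circNode R M m)⁻¹‖ ≤
      M * (2 * S * (25 / N) ^ (M - 1) * (25 / R) / (2 * s - 1)) + 2 * S * (1 / 2) ^ M := by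
  have hN' : (50 : ℝ) ≤ N := by exact_mod_cast hN
  have hN0 : (0 : ℝ) < N := by linarith
  have hR0 : 0 < R := hN0.trans_le hR
  have hS : 0 ≤ S := by simpa using (norm_nonneg _).trans (ha 0)
  have hs1 : 0 < 2 * s - 1 := by linarith
  have hW : (N : ℝ) ^ (1 - 2 * s) ≤ 1 :=
    Real.rpow_le_one_of_one_le_of_nonpos (by linarith) (by linarith)
  have hW0 : 0 ≤ (N : ℝ) ^ (1 - 2 * s) := by positivity
  set W : ℂ := (((N : ℝ) ^ (1 - 2 * s) : ℝ) : ℂ) with hWd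
  have hWn : ‖W‖ ≤ 1 := by rw [hWd, Complex.norm_real, Real.norm_of_nonneg hW0]; exact hW
  have hden : ∀ p : ℕ, ‖(p + 2 * s - 1 : ℂ)‖ = p + 2 * s - 1 := fun p => by
    have h1 : (p + 2 * s - 1 : ℂ) = ((p + 2 * s - 1 : ℝ) : ℂ) := by push_cast; ring
    rw [h1, Complex.norm_real, Real.norm_of_nonneg]
    linarith [(p.cast_nonneg : (0 : ℝ) ≤ p)]
  have hsum := hasSum_integral_series hN hs ha hg hh
  rw [← hWd] at hsum
  set T : ℕ → ℂ := fun p => W * (a p * (N : ℂ)⁻¹ ^ p / (p + 2 * s - 1)) with hT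
  set A : ℕ → ℂ := fun p => 1 / (M : ℂ) * ∑ m ∈ Finset.range M,
    Complex.exp (-(Real.pi * Complex.I * (p * (2 * m + 1) / M))) *
      g ((R⁻¹ : ℝ) * Complex.exp (Real.pi * Complex.I * ((2 * m + 1) / M))) with hA
  have hx1 : 25 / R ≤ 1 / 2 := by
    rw [div_le_div_iff₀ hR0 (by norm_num)]; linarith
  have hAp : ∀ p < M, ‖A p - a p * ((R⁻¹ : ℝ) : ℂ) ^ p‖ ≤ 2 * S * (25 / R) ^ M := fun p hp => by
    refine (norm_circle_average_sub_le (S := S) (x := 25 / R) (inv_nonneg.2 hR0.le)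
      (fun z hz => hg z ?_) (fun q => ?_) (by positivity) (by linarith) hp).trans ?_
    · rw [hz, ← one_div]
      exact one_div_lt_one_div_of_lt (by norm_num) (by linarith)
    · rw [div_eq_mul_inv, mul_pow, ← mul_assoc]
      gcongr
      exact ha q
    · have h2 : (25 / R) ^ M / (1 - 25 / R) ≤ (25 / R) ^ M / (1 / 2) := by
        gcongr
        linarith
      calc S * ((25 / R) ^ M / (1 - 25 / R)) ≤ S * ((25 / R) ^ M / (1 / 2)) := by gcongr
        _ = _ := by ring
  have hQ : 1 / (M : ℂ) * ∑ m ∈ Finset.range M, circWeight s N R M m * g (circNode R M m)⁻¹ =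
      ∑ p ∈ Finset.range M, W * (((R / N : ℝ) : ℂ) ^ p / (p + 2 * s - 1)) * A p := by
    simp only [hA, circWeight, inv_circNode, ← hWd, Finset.mul_sum, Finset.sum_mul]
    rw [Finset.sum_comm]
    refine Finset.sum_congr rfl fun p _ => Finset.sum_congr rfl fun m _ => ?_
    ring
  have hterm : ∀ p ∈ Finset.range M,
      ‖T p - W * (((R / N : ℝ) : ℂ) ^ p / (p + 2 * s - 1)) * A p‖ ≤
        2 * S * (25 / N) ^ (M - 1) * (25 / R) / (2 * s - 1) := by
    intro p hp
    have hpM := Finset.mem_range.1 hp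
    have h1 : T p - W * (((R / N : ℝ) : ℂ) ^ p / (p + 2 * s - 1)) * A p =
        -(W * (((R / N : ℝ) : ℂ) ^ p / (p + 2 * s - 1)) * (A p - a p * ((R⁻¹ : ℝ) : ℂ) ^ p)) := by
      have h2 : (N : ℂ)⁻¹ ^ p = ((R / N : ℝ) : ℂ) ^ p * ((R⁻¹ : ℝ) : ℂ) ^ p := by
        have hRc : (R : ℂ) ≠ 0 := by exact_mod_cast hR0.ne'
        rw [← mul_pow]
        congr 1
        push_cast
        field_simp
      simp only [hT]
      rw [h2]
      ring
    have hRN : 1 ≤ R / N := (one_le_div hN0).2 hR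
    rw [h1, norm_neg, norm_mul, norm_mul, norm_div, norm_pow, hden, Complex.norm_real (R / N),
      Real.norm_of_nonneg (show 0 ≤ R / N by positivity)]
    calc ‖W‖ * ((R / N) ^ p / (p + 2 * s - 1)) * ‖A p - a p * ((R⁻¹ : ℝ) : ℂ) ^ p‖
        ≤ 1 * ((R / N) ^ (M - 1) / (2 * s - 1)) * (2 * S * (25 / R) ^ M) := by
          refine mul_le_mul (mul_le_mul hWn ?_ ?_ zero_le_one) (hAp p hpM) (norm_nonneg _)
            (by positivity)
          · refine div_le_div₀ (by positivity) (pow_le_pow_right₀ hRN (by omega)) hs1 ?_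
            · linarith [(p.cast_nonneg : (0 : ℝ) ≤ p)]
          · have : 0 ≤ (p : ℝ) + 2 * s - 1 := by linarith [(p.cast_nonneg : (0 : ℝ) ≤ p)]
            positivity
      _ = 2 * S * ((R / N) * (25 / R)) ^ (M - 1) * (25 / R) / (2 * s - 1) := by
          obtain ⟨k, rfl⟩ : ∃ k, M = k + 1 := ⟨M - 1, by omega⟩
          rw [Nat.add_sub_cancel, mul_pow, pow_succ]
          ring
      _ = _ := by
          rw [show R / N * (25 / R) = 25 / N by field_simp]
  have htail : ‖(∫ t in Ioi (N : ℝ), h t) - ∑ p ∈ Finset.range M, T p‖ ≤ 2 * S * (1 / 2) ^ M := by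
    have h1 := (hasSum_nat_add_iff' M).2 hsum
    have h2 : HasSum (fun q : ℕ => S * (1 / 2 : ℝ) ^ M * (1 / 2) ^ q) (S * (1 / 2 : ℝ) ^ M * 2) :=
      hasSum_geometric_two.mul_left _
    refine (h1.norm_le_of_bounded h2 fun q => ?_).trans (le_of_eq (by ring))
    -- In the tail p ≥ M ≥ 1, so the denominators are at least 1 and no factor 1 / (2s - 1) appears.
    have hq : (1 : ℝ) ≤ ((q + M : ℕ) : ℝ) := by exact_mod_cast (by omega : 1 ≤ q + M)
    simp only [hT]
    rw [norm_mul, norm_div, norm_mul, norm_pow, norm_inv, Complex.norm_natCast, hden]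
    calc ‖W‖ * (‖a (q + M)‖ * (N : ℝ)⁻¹ ^ (q + M) / (((q + M : ℕ) : ℝ) + 2 * s - 1))
        ≤ 1 * (S * 25 ^ (q + M) * (N : ℝ)⁻¹ ^ (q + M) / 1) := by
          refine mul_le_mul hWn ?_ ?_ zero_le_one
          · gcongr
            · exact ha _
            · linarith
          · exact div_nonneg (by positivity) (by linarith)
      _ = S * (25 / N) ^ (q + M) := by rw [div_eq_mul_inv 25, mul_pow]; ring
      _ ≤ S * (1 / 2) ^ (q + M) := by
          refine mul_le_mul_of_nonneg_left (pow_le_pow_left₀ (by positivity) ?_ _) hS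
          rw [div_le_div_iff₀ hN0 (by norm_num)]; linarith
      _ = _ := by rw [pow_add]; ring
  calc _ = ‖(∑ p ∈ Finset.range M, (T p - W * (((R / N : ℝ) : ℂ) ^ p / (p + 2 * s - 1)) * A p)) +
        ((∫ t in Ioi (N : ℝ), h t) - ∑ p ∈ Finset.range M, T p)‖ := by
        rw [hQ, Finset.sum_sub_distrib]; congr 1; ring
    _ ≤ _ := by
        refine (norm_add_le _ _).trans (add_le_add ((norm_sum_le_of_le _ hterm).trans ?_) htail)
        rw [Finset.sum_const, Finset.card_range, nsmul_eq_mul]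

/-! ### One branch as a holomorphic function of n. -/

/-- Two arguments in (-π/2, π/2) add up to one in (-π, π). This keeps the Jacobians off the cut of
the principal power. -/
theorem mul_mem_slitPlane_of_re_pos {a b : ℂ} (ha : 0 < a.re) (hb : 0 < b.re) :
    a * b ∈ Complex.slitPlane := by
  rw [Complex.mem_slitPlane_iff]
  by_contra! h
  rw [Complex.mul_re, Complex.mul_im] at h
  obtain ⟨h1, h2⟩ := h
  have h3 : a.re * (a.re * b.re - a.im * b.im) = (a.re ^ 2 + a.im ^ 2) * b.re := by
    linear_combination -a.im * h2
  have h4 : 0 < (a.re ^ 2 + a.im ^ 2) * b.re := by positivity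
  linarith [mul_nonpos_of_nonneg_of_nonpos ha.le h1]

theorem inv_re_pos {a : ℂ} (ha : 0 < a.re) : 0 < (a⁻¹).re := by
  rw [Complex.inv_re]
  exact div_pos ha (Complex.normSq_pos.2 fun h => by simp [h] at ha)

theorem div_mul_mem_slitPlane {c : ℝ} (hc : 0 < c) {a b : ℂ} (ha : 0 < a.re) (hb : 0 < b.re) :
    (c : ℂ) / (a * b) ∈ Complex.slitPlane := by
  rw [div_eq_mul_inv, mul_inv, ← mul_assoc]
  refine mul_mem_slitPlane_of_re_pos ?_ (inv_re_pos hb)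
  rw [Complex.re_ofReal_mul]
  exact mul_pos hc (inv_re_pos ha)

/-- The data that describe one branch of the transfer operator at a fixed real point: the Jacobian
is `c / ((n + p) (n + conj p))`, and `φ ∘ G_n` is the function `Φ` of `1 / n`. -/
structure BranchData where
  p : ℂ
  c : ℝ
  B : ℝ
  Φ : ℂ → ℂ
  norm_p : ‖p‖ ≤ 5
  c_pos : 0 < c
  c_le : c ≤ 4
  diff : DifferentiableOn ℂ Φ (Metric.ball 0 (1 / 24))
  bound : ∀ u ∈ Metric.ball (0 : ℂ) (1 / 24), ‖Φ u‖ ≤ B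

namespace BranchData

variable (D : BranchData) (s : ℝ)

/-- The Jacobian as a function of `n`. -/
noncomputable def jac (n : ℂ) : ℂ := D.c / ((n + D.p) * (n + conj D.p))

/-- The regularized Jacobian `n² J_n` as a function of `u = 1 / n`. -/
noncomputable def jacInf (u : ℂ) : ℂ := D.c / ((1 + D.p * u) * (1 + conj D.p * u))

/-- The summand as a function of `n`. -/
noncomputable def h (n : ℂ) : ℂ := D.jac n ^ (s : ℂ) * D.Φ n⁻¹

/-- The regularized summand as a function of `u = 1 / n`. -/
noncomputable def g (u : ℂ) : ℂ := D.jacInf u ^ (s : ℂ) * D.Φ u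

theorem B_nonneg : 0 ≤ D.B :=
  (norm_nonneg _).trans (D.bound 0 (Metric.mem_ball_self (by norm_num)))

theorem norm_conj_p : ‖conj D.p‖ ≤ 5 := by rw [Complex.norm_conj]; exact D.norm_p

theorem re_add_pos {n p : ℂ} (hp : ‖p‖ ≤ 5) (hn : 24 < n.re) : 19 < (n + p).re := by
  have := (abs_le.1 (Complex.abs_re_le_norm p)).1
  rw [Complex.add_re]
  linarith

theorem re_one_add_pos {u p : ℂ} (hp : ‖p‖ ≤ 5) (hu : ‖u‖ < 1 / 24) :
    19 / 24 ≤ (1 + p * u).re := by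
  have h1 := (abs_le.1 (Complex.abs_re_le_norm (p * u))).1
  have h2 : ‖p * u‖ ≤ 5 / 24 := by
    rw [norm_mul]; nlinarith [norm_nonneg p, norm_nonneg u]
  rw [Complex.add_re, Complex.one_re]
  linarith

/-- The origin of the base 7: 4 · (24/19)² < 7. -/
theorem norm_div_mul_le {c : ℝ} {a b : ℂ} (hc0 : 0 < c) (hc : c ≤ 4) (ha : 19 / 24 ≤ a.re)
    (hb : 19 / 24 ≤ b.re) : ‖(c : ℂ) / (a * b)‖ ≤ 7 := by
  have h1 := ha.trans (Complex.re_le_norm a)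
  have h2 := hb.trans (Complex.re_le_norm b)
  rw [norm_div, norm_mul, Complex.norm_real, Real.norm_of_nonneg hc0.le,
    div_le_iff₀ (mul_pos (by linarith) (by linarith))]
  nlinarith [mul_le_mul h1 h2 (by norm_num) (norm_nonneg a)]

theorem inv_mem_ball {n : ℂ} (hn : 24 < n.re) : n⁻¹ ∈ Metric.ball (0 : ℂ) (1 / 24) := by
  rw [mem_ball_zero_iff, norm_inv, ← one_div]
  exact one_div_lt_one_div_of_lt (by norm_num) (hn.trans_le (Complex.re_le_norm n))

theorem isOpen_re : IsOpen {n : ℂ | 24 < n.re} := isOpen_lt continuous_const Complex.continuous_re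

theorem differentiableOn_h : DifferentiableOn ℂ (D.h s) {n : ℂ | 24 < n.re} := by
  intro n hn
  have h1 := re_add_pos D.norm_p hn
  have h2 := re_add_pos D.norm_conj_p hn
  have hj : DifferentiableAt ℂ D.jac n := by
    unfold jac
    refine (differentiableAt_const _).div (by fun_prop) (mul_ne_zero ?_ ?_)
    · intro h; rw [h, Complex.zero_re] at h1; linarith
    · intro h; rw [h, Complex.zero_re] at h2; linarith
  have hn0 : n ≠ 0 := by rintro rfl; simp at hn; linarith
  have hΦ : DifferentiableAt ℂ (fun n : ℂ => D.Φ n⁻¹) n :=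
    (D.diff.differentiableAt (Metric.isOpen_ball.mem_nhds (inv_mem_ball hn))).comp n
      (differentiableAt_inv hn0)
  exact ((hj.cpow_const (div_mul_mem_slitPlane D.c_pos (by linarith) (by linarith))).mul
    hΦ).differentiableWithinAt

theorem differentiableOn_g : DifferentiableOn ℂ (D.g s) (Metric.ball 0 (1 / 24)) := by
  intro u hu
  have hu' := mem_ball_zero_iff.1 hu
  have h1 := re_one_add_pos D.norm_p hu'
  have h2 := re_one_add_pos D.norm_conj_p hu'
  have hj : DifferentiableAt ℂ D.jacInf u := by
    unfold jacInf
    refine (differentiableAt_const _).div (by fun_prop) (mul_ne_zero ?_ ?_)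
    · intro h; rw [h, Complex.zero_re] at h1; linarith
    · intro h; rw [h, Complex.zero_re] at h2; linarith
  exact ((hj.cpow_const (div_mul_mem_slitPlane D.c_pos (by linarith) (by linarith))).mul
    (D.diff.differentiableAt (Metric.isOpen_ball.mem_nhds hu))).differentiableWithinAt

variable {s}

theorem norm_h_le (hs : 0 < s) {n : ℂ} (hn : 24 < n.re) : ‖D.h s n‖ ≤ 7 ^ s * D.B := by
  rw [h, norm_mul, Complex.norm_cpow_real]
  refine mul_le_mul (Real.rpow_le_rpow (norm_nonneg _) ?_ hs.le) (D.bound _ (inv_mem_ball hn))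
    (norm_nonneg _) (by positivity)
  exact norm_div_mul_le D.c_pos D.c_le (by linarith [re_add_pos D.norm_p hn])
    (by linarith [re_add_pos D.norm_conj_p hn])

theorem norm_g_le (hs : 0 < s) {u : ℂ} (hu : u ∈ Metric.ball (0 : ℂ) (1 / 24)) :
    ‖D.g s u‖ ≤ 7 ^ s * D.B := by
  have hu' := mem_ball_zero_iff.1 hu
  rw [g, norm_mul, Complex.norm_cpow_real]
  refine mul_le_mul (Real.rpow_le_rpow (norm_nonneg _) ?_ hs.le) (D.bound _ hu)
    (norm_nonneg _) (by positivity)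
  exact norm_div_mul_le D.c_pos D.c_le (re_one_add_pos D.norm_p hu')
    (re_one_add_pos D.norm_conj_p hu')

theorem jac_eq {n : ℂ} (hn : n ≠ 0) : n ^ 2 * D.jac n = D.jacInf n⁻¹ := by
  rw [jac, jacInf]
  have h1 : (1 + D.p * n⁻¹) * (1 + conj D.p * n⁻¹) =
      ((n + D.p) * (n + conj D.p)) / n ^ 2 := by field_simp
  rw [h1, div_div_eq_mul_div]
  ring

/-- For real t both factors of the Jacobian are nonnegative reals, so the principal power is
multiplicative. Real t suffices, since the identity is only used under the integral and for decay.
-/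
theorem h_ofReal {t : ℝ} (ht : 0 < t) :
    D.h s t = ((t ^ (-(2 * s)) : ℝ) : ℂ) * D.g s (t : ℂ)⁻¹ := by
  have ht0 : (t : ℂ) ≠ 0 := by exact_mod_cast ht.ne'
  have h1 : D.jacInf (t : ℂ)⁻¹ = ((D.c / ‖1 + D.p * (t : ℂ)⁻¹‖ ^ 2 : ℝ) : ℂ) := by
    have : 1 + conj D.p * (t : ℂ)⁻¹ = conj (1 + D.p * (t : ℂ)⁻¹) := by
      simp [Complex.conj_ofReal]
    rw [jacInf, this, Complex.mul_conj']
    push_cast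
    rfl
  have h2 : D.jac t = ((t ^ (-2 : ℝ) : ℝ) : ℂ) * D.jacInf (t : ℂ)⁻¹ := by
    rw [← D.jac_eq ht0, Real.rpow_neg ht.le, Real.rpow_two]
    push_cast
    field_simp
  rw [h, g, h2, h1, Complex.mul_cpow_ofReal_nonneg (by positivity)
    (div_nonneg D.c_pos.le (by positivity)), ← Complex.ofReal_cpow (by positivity),
    ← Real.rpow_mul ht.le]
  rw [show (-2 * s) = -(2 * s) by ring, mul_assoc]

theorem norm_h_ofReal_le (hs : 0 < s) {t : ℝ} (ht : 24 < t) :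
    ‖D.h s t‖ ≤ 7 ^ s * D.B * t ^ (-(2 * s)) := by
  have ht0 : 0 < t := by linarith
  rw [D.h_ofReal ht0, norm_mul, Complex.norm_real, Real.norm_of_nonneg (by positivity), mul_comm]
  gcongr
  exact D.norm_g_le hs (inv_mem_ball (by simpa using ht))

theorem summable_h (hs : 1 / 2 < s) : Summable fun n : ℕ => D.h s n := by
  have h1 : Summable fun n : ℕ => 7 ^ s * D.B * (n : ℝ) ^ (-(2 * s)) :=
    (Real.summable_nat_rpow.2 (by linarith)).mul_left _
  refine h1.of_norm_bounded_eventually_nat ?_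
  filter_upwards [eventually_gt_atTop 24] with n hn
  have := D.norm_h_ofReal_le (s := s) (by linarith) (t := n) (by exact_mod_cast hn)
  simpa using this

open MeasureTheory in
theorem integrable_h (hs : 1 / 2 < s) {N : ℝ} (hN : 24 < N) :
    IntegrableOn (fun t : ℝ => D.h s t) (Set.Ioi N) := by
  have h1 : IntegrableOn (fun t : ℝ => 7 ^ s * D.B * t ^ (-(2 * s))) (Set.Ioi N) :=
    (integrableOn_Ioi_rpow_of_lt (by linarith) (by linarith)).const_mul _
  refine h1.mono' (ContinuousOn.aestronglyMeasurable ?_ measurableSet_Ioi) ?_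
  · refine (D.differentiableOn_h s).continuousOn.comp Complex.continuous_ofReal.continuousOn ?_
    intro t ht
    simpa using hN.trans ht
  · refine (ae_restrict_iff' measurableSet_Ioi).2 (Eventually.of_forall fun t ht => ?_)
    exact D.norm_h_ofReal_le (by linarith) (hN.trans ht)

/-- The weighted sum over the nodes on the circle of radius `τ_N` about `N` approximates the
derivative terms of the Euler-Maclaurin formula. -/
theorem norm_deriv_sum_le (hs : 1 / 2 < s) {L : ℕ} (hL : 1 ≤ L) {N M : ℕ} (hN : N = 10 + 64 * L)
    (hM : M = 8 * L) :
    ‖1 / (M : ℂ) * ∑ m ∈ Finset.Icc 1 M, derivWeight N L M m * D.h s (derivNode N M m) +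
      ∑ l ∈ Finset.Icc 1 L, (bern (2 * l) 0 : ℂ) * iteratedDeriv (2 * l - 1) (D.h s) N‖ ≤
      4 * (7 ^ s * D.B) * (1 / 2) ^ L := by
  have hs0 : 0 < s := by linarith
  set S : ℝ := 7 ^ s * D.B with hSd
  have hS : 0 ≤ S := mul_nonneg (by positivity) D.B_nonneg
  have hLr : (1 : ℝ) ≤ L := by exact_mod_cast hL
  have hNr : (N : ℝ) = 10 + 64 * L := by rw [hN]; push_cast; ring
  have he2 : 2.7 < Real.exp 1 := by linarith [Real.exp_one_gt_d9]
  have he3 : Real.exp 1 < 3 := by linarith [Real.exp_one_lt_d9]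
  have htau : tau N = 64 * L / Real.exp 1 := by rw [tau, nuA, hNr]; ring
  have htauL : 2 * (L : ℝ) ≤ tau N := by
    rw [htau, le_div_iff₀ (by linarith)]; nlinarith
  have htau0 : 0 < tau N := by linarith
  -- Ratio of the node circle to the Taylor disc of radius (N - 10) / 2 = 32L; as 2/e < 3/4 and
  -- (3/4)^8 < 1/4, the choice M = 8L makes the aliasing O(4^(-L)).
  have hx : tau N / (32 * L) = 2 / Real.exp 1 := by rw [htau]; field_simp; norm_num
  have hx1 : 2 / Real.exp 1 ≤ 3 / 4 := by
    rw [div_le_div_iff₀ (by linarith) (by norm_num)]; linarith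
  have hball : Metric.closedBall (N : ℂ) (32 * L) ⊆ {n : ℂ | 24 < n.re} := fun z hz => by
    rw [mem_closedBall_iff_norm] at hz
    have h1 := (abs_le.1 ((Complex.abs_re_le_norm (z - N)).trans hz)).1
    rw [Complex.sub_re, Complex.natCast_re, hNr] at h1
    show 24 < z.re
    linarith
  obtain ⟨hT1, hT2⟩ := hasSum_taylor (R := 32 * L) (by linarith) (D.differentiableOn_h s) hball
    (fun z hz => D.norm_h_le hs0 hz)
  set a : ℕ → ℂ := fun k => iteratedDeriv k (D.h s) N / k.factorial with ha
  set A : ℕ → ℂ := fun k => 1 / (M : ℂ) * ∑ m ∈ Finset.range M,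
    Complex.exp (-(Real.pi * Complex.I * (k * (2 * m + 1) / M))) *
      D.h s (N + tau N * Complex.exp (Real.pi * Complex.I * ((2 * m + 1) / M))) with hA
  have hAk : ∀ k < M, ‖A k - a k * (tau N : ℂ) ^ k‖ ≤ 4 * S * (1 / 4) ^ L := fun k hk => by
    refine (norm_circle_average_sub_le (F := fun z => D.h s (N + z)) (S := S)
      (x := 2 / Real.exp 1) htau0.le (fun z hz => hT2 z ?_) (fun q => ?_) (by positivity)
      (by linarith) hk).trans ?_
    · rw [hz]
      have : tau N = 2 / Real.exp 1 * (32 * L) := by rw [← hx]; field_simp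
      rw [this]
      nlinarith
    · rw [← hx, div_pow, ← mul_div_assoc, le_div_iff₀ (by positivity)]
      calc _ = ‖a q‖ * (32 * L) ^ q * tau N ^ q := by ring
        _ ≤ S * tau N ^ q := by gcongr; exact hT1 q
    · have h1 : (2 / Real.exp 1) ^ M ≤ (1 / 4) ^ L := by
        rw [hM, pow_mul]
        refine pow_le_pow_left₀ (by positivity) ?_ _
        calc (2 / Real.exp 1) ^ 8 ≤ (3 / 4) ^ 8 := pow_le_pow_left₀ (by positivity) hx1 _
          _ ≤ _ := by norm_num
      have h2 : (2 / Real.exp 1) ^ M / (1 - 2 / Real.exp 1) ≤ (1 / 4) ^ L / (1 / 4) :=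
        div_le_div₀ (by positivity) h1 (by norm_num) (by linarith)
      calc S * ((2 / Real.exp 1) ^ M / (1 - 2 / Real.exp 1)) ≤ S * ((1 / 4) ^ L / (1 / 4)) := by
            gcongr
        _ = _ := by ring
  have hsum : 1 / (M : ℂ) * ∑ m ∈ Finset.Icc 1 M, derivWeight N L M m * D.h s (derivNode N M m) =
      -∑ l ∈ Finset.Icc 1 L, (bernoulli (2 * l) : ℂ) / (2 * l) * ((tau N : ℂ) ^ (2 * l - 1))⁻¹ *
        A (2 * l - 1) := by
    -- Shifting m by one turns the numerators 2m - 1 of the angles into 2m + 1.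
    have hre : Finset.Icc 1 M = (Finset.range M).image (· + 1) := by
      ext m
      simp only [Finset.mem_Icc, Finset.mem_image, Finset.mem_range]
      exact ⟨fun h => ⟨m - 1, by omega, by omega⟩, by rintro ⟨k, hk, rfl⟩; omega⟩
    have hnode : ∀ m : ℕ, derivNode N M (m + 1) =
        N + tau N * Complex.exp (Real.pi * Complex.I * ((2 * m + 1) / M)) := fun m => by
      rw [derivNode]
      congr 3
      push_cast
      ring
    rw [hre, Finset.sum_image (fun _ _ _ _ h => Nat.succ_injective h)]
    simp only [hA, hnode, derivWeight, neg_mul, Finset.sum_neg_distrib, mul_neg, Finset.mul_sum,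
      Finset.sum_mul]
    rw [Finset.sum_comm]
    congr 1
    refine Finset.sum_congr rfl fun l hl => Finset.sum_congr rfl fun m _ => ?_
    have hl1 := (Finset.mem_Icc.1 hl).1
    have hexp : Complex.exp (-(2 * Real.pi * Complex.I *
        ((2 * l - 1) * (2 * ((m + 1 : ℕ) : ℂ) - 1) / (2 * M)))) =
        Complex.exp (-(Real.pi * Complex.I * (((2 * l - 1 : ℕ) : ℂ) * (2 * m + 1) / M))) := by
      congr 1
      push_cast [Nat.cast_sub (by omega : 1 ≤ 2 * l)]
      ring
    rw [hexp]
    ring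
  have hterm : ∀ l ∈ Finset.Icc 1 L,
      ‖(bern (2 * l) 0 : ℂ) * iteratedDeriv (2 * l - 1) (D.h s) N -
        (bernoulli (2 * l) : ℂ) / (2 * l) * ((tau N : ℂ) ^ (2 * l - 1))⁻¹ * A (2 * l - 1)‖ ≤
      4 * S * (1 / 4) ^ L := by
    intro l hl
    obtain ⟨hl1, hl2⟩ := Finset.mem_Icc.1 hl
    set k := 2 * l - 1 with hk
    have hkl : 2 * l = k + 1 := by omega
    have htc : (tau N : ℂ) ^ k ≠ 0 := pow_ne_zero _ (by exact_mod_cast htau0.ne')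
    have hb : (bernoulli (2 * l) : ℂ) / (2 * l) = (bern (2 * l) 0 : ℂ) * k.factorial := by
      have h1 : ((2 * l : ℕ) : ℂ) = 2 * l := by push_cast; ring
      rw [bern_zero_eq, ← h1, hkl, Nat.factorial_succ]
      have h2 : ((k + 1 : ℕ) : ℂ) ≠ 0 := by exact_mod_cast Nat.succ_ne_zero k
      have h3 : (k.factorial : ℂ) ≠ 0 := by exact_mod_cast k.factorial_ne_zero
      push_cast at h2 ⊢
      field_simp
    have heq : (bern (2 * l) 0 : ℂ) * iteratedDeriv k (D.h s) N -
        (bernoulli (2 * l) : ℂ) / (2 * l) * ((tau N : ℂ) ^ k)⁻¹ * A k =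
        -((bern (2 * l) 0 : ℂ) * (k.factorial * ((tau N : ℂ) ^ k)⁻¹) *
          (A k - a k * (tau N : ℂ) ^ k)) := by
      have h3 : (k.factorial : ℂ) ≠ 0 := by exact_mod_cast k.factorial_ne_zero
      rw [hb, ha]
      field_simp
      ring
    -- The factorial from the derivative is absorbed by τ^k because k ≤ 2L ≤ τ.
    have hf : (k.factorial : ℝ) ≤ tau N ^ k := by
      have h1 : (k.factorial : ℝ) ≤ (k : ℝ) ^ k := by exact_mod_cast k.factorial_le_pow
      have h2 : (k : ℝ) ≤ 2 * L := by exact_mod_cast (by omega : k ≤ 2 * L)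
      exact h1.trans (pow_le_pow_left₀ k.cast_nonneg (h2.trans htauL) _)
    rw [heq, norm_neg, norm_mul]
    refine (mul_le_of_le_one_left (norm_nonneg _) ?_).trans (hAk k (by omega))
    rw [norm_mul, norm_mul, norm_inv, norm_pow, Complex.norm_natCast, Complex.norm_real,
      Complex.norm_real, Real.norm_of_nonneg htau0.le, Real.norm_eq_abs, ← div_eq_mul_inv]
    exact mul_le_one₀ (abs_bern_le _ ⟨le_rfl, zero_le_one⟩) (by positivity)
      ((div_le_one (by positivity)).2 hf)
  rw [hsum, neg_add_eq_sub, ← Finset.sum_sub_distrib]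
  refine (norm_sum_le_of_le _ hterm).trans ?_
  have hL2 : (L : ℝ) ≤ 2 ^ L := by exact_mod_cast L.lt_two_pow_self.le
  rw [Finset.sum_const, Nat.card_Icc, nsmul_eq_mul, Nat.add_sub_cancel]
  calc (L : ℝ) * (4 * S * (1 / 4) ^ L) ≤ 2 ^ L * (4 * S * (1 / 4) ^ L) := by gcongr
    _ = 4 * S * (2 * (1 / 4)) ^ L := by rw [mul_pow]; ring
    _ = _ := by norm_num

/-- The constant collects the Euler-Maclaurin remainder, the derivative nodes, the aliasing and the
truncation of the integral: 302 = 288 + 4 + 8 + 2. -/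
theorem norm_branch_le (hs : 1 / 2 < s) {L : ℕ} (hL : 1 ≤ L) {N M M' : ℕ} (hN : N = 10 + 64 * L)
    (hM : M = 8 * L) (hM' : M' = 4 * L) {R : ℝ} (hR : N ≤ R)
    (hRs : (25 / (N : ℝ)) ^ (M' - 1) * (25 / R) ≤ (2 * s - 1) * (1 / 8) ^ L) :
    ‖∑' i : ℕ, D.h s (N + i : ℕ) - (1 / 2 * D.h s N +
      1 / (M : ℂ) * ∑ m ∈ Finset.Icc 1 M, derivWeight N L M m * D.h s (derivNode N M m) +
      1 / (M' : ℂ) * ∑ m ∈ Finset.range M',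
        circWeight s N R M' m * D.g s (circNode R M' m)⁻¹)‖ ≤
      302 * (7 ^ s * D.B) * (1 / 2) ^ L := by
  have hs0 : 0 < s := by linarith
  have hderiv := D.norm_deriv_sum_le hs hL hN hM
  set S : ℝ := 7 ^ s * D.B with hSd
  have hS : 0 ≤ S := mul_nonneg (by positivity) D.B_nonneg
  have hLr : (1 : ℝ) ≤ L := by exact_mod_cast hL
  have hNr : (N : ℝ) = 10 + 64 * L := by rw [hN]; push_cast; ring
  have hem := norm_em_tail_le isOpen_re (D.differentiableOn_h s) (fun z hz => D.norm_h_le hs0 hz)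
    hL hN (fun t ht z hz => by
      rw [mem_closedBall_iff_norm] at hz
      have h1 := (abs_le.1 ((Complex.abs_re_le_norm (z - t)).trans hz)).1
      rw [Complex.sub_re, Complex.ofReal_re] at h1
      show 24 < z.re
      linarith) (by
      have := (summable_nat_add_iff N).2 (D.summable_h hs)
      simpa only [add_comm] using this)
    (D.integrable_h hs (by linarith))
  obtain ⟨hT1, hT2⟩ := hasSum_taylor (c := 0) (R := 1 / 25) (by norm_num) (D.differentiableOn_g s)
    (Metric.closedBall_subset_ball (by norm_num)) (fun z hz => D.norm_g_le hs0 hz)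
  have hquad := norm_integral_sub_quadrature_le (M := M') (by omega) hR (by omega) hs
    (fun p => by
      have := hT1 p
      rwa [one_div, inv_pow, ← div_eq_mul_inv, div_le_iff₀ (by positivity)] at this)
    (fun u hu => by simpa only [zero_add] using hT2 u hu)
    (fun t ht => D.h_ofReal (s := s) (show 0 < t by linarith))
  rw [← hSd] at hem hquad
  set X := ∑' i : ℕ, D.h s (N + i : ℕ)
  set I := ∫ t in Set.Ioi (N : ℝ), D.h s t
  set E := ∑ l ∈ Finset.Icc 1 L, (bern (2 * l) 0 : ℂ) * iteratedDeriv (2 * l - 1) (D.h s) N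
  set Q := 1 / (M' : ℂ) * ∑ m ∈ Finset.range M',
    circWeight s N R M' m * D.g s (circNode R M' m)⁻¹
  set Y := 1 / (M : ℂ) * ∑ m ∈ Finset.Icc 1 M, derivWeight N L M m * D.h s (derivNode N M m)
  have hsplit : X - (1 / 2 * D.h s N + Y + Q) =
      (X - (1 / 2 * D.h s N + I) + E) - (Y + E) + (I - Q) := by ring
  have h1 : 288 * S * (1 / 16) ^ L ≤ 288 * S * (1 / 2) ^ L := by gcongr; norm_num
  have h2 : M' * (2 * S * (25 / (N : ℝ)) ^ (M' - 1) * (25 / R) / (2 * s - 1)) ≤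
      8 * S * (1 / 2) ^ L := by
    have hL2 : (L : ℝ) ≤ 2 ^ L := by exact_mod_cast L.lt_two_pow_self.le
    have hs1 : 0 < 2 * s - 1 := by linarith
    have h3 : (25 / (N : ℝ)) ^ (M' - 1) * (25 / R) / (2 * s - 1) ≤ (1 / 8) ^ L := by
      rw [div_le_iff₀ hs1, mul_comm _ (2 * s - 1)]; exact hRs
    calc M' * (2 * S * (25 / (N : ℝ)) ^ (M' - 1) * (25 / R) / (2 * s - 1))
        = M' * (2 * S) * ((25 / (N : ℝ)) ^ (M' - 1) * (25 / R) / (2 * s - 1)) := by ring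
      _ ≤ M' * (2 * S) * (1 / 8) ^ L := by gcongr
      _ = L * (8 * S * (1 / 8) ^ L) := by rw [hM']; push_cast; ring
      _ ≤ 2 ^ L * (8 * S * (1 / 8) ^ L) := by gcongr
      _ = 8 * S * (2 * (1 / 8)) ^ L := by rw [mul_pow]; ring
      _ ≤ _ := by gcongr; norm_num
  have h3 : 2 * S * (1 / 2) ^ M' ≤ 2 * S * (1 / 2) ^ L := by
    refine mul_le_mul_of_nonneg_left (pow_le_pow_of_le_one (by norm_num) (by norm_num) ?_)
      (by positivity)
    omega
  rw [hsplit]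
  refine (norm_add_le _ _).trans ?_
  have := norm_sub_le (X - (1 / 2 * D.h s N + I) + E) (Y + E)
  linarith

end BranchData

/-! ### Geometry of the Bernstein ellipse. -/

theorem one_add_sq_div_two_le_cosh (t : ℝ) : 1 + t ^ 2 / 2 ≤ Real.cosh t := by
  have h := Real.cosh_two_mul (t / 2)
  have h1 := Real.cosh_sq (t / 2)
  have h2 : (t / 2) ^ 2 ≤ Real.sinh (t / 2) ^ 2 := by
    rw [sq_le_sq, Real.abs_sinh]
    exact Real.self_le_sinh_iff.2 (abs_nonneg _)
  rw [mul_div_cancel₀ t two_ne_zero] at h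
  nlinarith

/-- The point cos(a + it) lies on the ellipse with foci ±1 and sum of focal distances 2 cosh t. The
triangle inequality through x bounds that sum by 2 + 2δ, and cosh t ≥ 1 + t²/2. -/
theorem exists_eq_cos {z : ℂ} {x δ : ℝ} (hx : x ∈ Set.Icc (-1 : ℝ) 1) (hz : ‖z - x‖ ≤ δ) :
    ∃ a t : ℝ, t ^ 2 ≤ 2 * δ ∧ z = Complex.cos (a + Complex.I * t) := by
  obtain ⟨ζ, hζ⟩ := Complex.cos_surjective z
  refine ⟨ζ.re, ζ.im, ?_, by rw [mul_comm Complex.I, Complex.re_add_im, hζ]⟩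
  set a := ζ.re
  set t := ζ.im
  have hza : z = ((Real.cos a * Real.cosh t : ℝ) : ℂ) -
      ((Real.sin a * Real.sinh t : ℝ) : ℂ) * Complex.I := by
    rw [← hζ, ← Complex.re_add_im ζ, Complex.cos_add_mul_I]
    push_cast
    rfl
  have hsq : ∀ e : ℝ, e ^ 2 = 1 →
      ‖z - (e : ℂ)‖ ^ 2 = (Real.cosh t - e * Real.cos a) ^ 2 := by
    intro e he
    rw [← Complex.normSq_eq_norm_sq, Complex.normSq_apply, hza]
    simp only [Complex.sub_re, Complex.sub_im, Complex.mul_re, Complex.mul_im, Complex.ofReal_re,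
      Complex.ofReal_im, Complex.I_re, Complex.I_im]
    have h1 := Real.cosh_sq t
    have h2 := Real.sin_sq_add_cos_sq a
    have h3 : Real.sin a ^ 2 = 1 - Real.cos a ^ 2 := by linarith
    have h4 : Real.sinh t ^ 2 = Real.cosh t ^ 2 - 1 := by linarith
    have h5 : (Real.sin a * Real.sinh t) ^ 2 =
        (1 - Real.cos a ^ 2) * (Real.cosh t ^ 2 - 1) := by rw [mul_pow, h3, h4]
    linear_combination h5 + (1 - Real.cos a ^ 2) * he
  have hle : ∀ e : ℝ, e ^ 2 = 1 → Real.cosh t - e * Real.cos a ≤ ‖z - (e : ℂ)‖ := fun e he =>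
    (le_abs_self _).trans (abs_le_of_sq_le_sq (hsq e he).ge (norm_nonneg _))
  have htri : ∀ e : ℝ, ‖z - (e : ℂ)‖ ≤ δ + |x - e| := fun e => by
    have h1 : z - (e : ℂ) = (z - x) + ((x - e : ℝ) : ℂ) := by push_cast; ring
    rw [h1]
    refine (norm_add_le _ _).trans (add_le_add hz ?_)
    rw [Complex.norm_real, Real.norm_eq_abs]
  have h1 := (hle 1 (by norm_num)).trans (htri 1)
  have h2 := (hle (-1) (by norm_num)).trans (htri (-1))
  rw [abs_of_nonpos (by linarith [hx.2])] at h1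
  rw [abs_of_nonneg (by linarith [hx.1])] at h2
  have h3 := one_add_sq_div_two_le_cosh t
  linarith

/-- Each coordinate contributes at most 2/9 to t² + u², and 4/9 < 0.81. -/
theorem mem_bernstein_of_norm_sub_le {z : ℂ × ℂ} {x y : ℝ} (hx : x ∈ Set.Icc (-1 : ℝ) 1)
    (hy : y ∈ Set.Icc (-1 : ℝ) 1) (h1 : ‖z.1 - x‖ ≤ 1 / 9) (h2 : ‖z.2 - y‖ ≤ 1 / 9) :
    z ∈ bernstein rA := by
  obtain ⟨a, t, ht, hz1⟩ := exists_eq_cos hx h1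
  obtain ⟨b, u, hu, hz2⟩ := exists_eq_cos hy h2
  refine ⟨a, b, t, u, ?_, Prod.ext hz1 hz2⟩
  rw [rA]
  norm_num at ht hu ⊢
  linarith

theorem isBounded_bernstein (r : ℝ) : Bornology.IsBounded (bernstein r) := by
  have hcos : ∀ a t : ℝ, |t| ≤ |r| → ‖Complex.cos (a + Complex.I * t)‖ ≤ Real.exp |r| := by
    intro a t ht
    have h1 : ((a + Complex.I * t) * Complex.I).re = -t := by simp
    have h2 : (-(a + Complex.I * t) * Complex.I).re = t := by simp
    have h3 : Real.exp (-t) ≤ Real.exp |r| := Real.exp_le_exp.2 ((neg_le_abs t).trans ht)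
    have h4 : Real.exp t ≤ Real.exp |r| := Real.exp_le_exp.2 ((le_abs_self t).trans ht)
    rw [Complex.cos, norm_div, Complex.norm_two, div_le_iff₀ two_pos]
    refine (norm_add_le _ _).trans ?_
    rw [Complex.norm_exp, Complex.norm_exp, h1, h2]
    linarith
  refine (Metric.isBounded_closedBall (x := (0 : ℂ × ℂ)) (r := Real.exp |r|)).subset ?_
  rintro z ⟨a, b, t, u, h, rfl⟩
  rw [mem_closedBall_zero_iff, Prod.norm_def]
  exact max_le (hcos a t (sq_le_sq.1 (by nlinarith))) (hcos b u (sq_le_sq.1 (by nlinarith)))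

/-- Compactness of the closure makes the supremum finite; a real `iSup` of an unbounded family would
be 0. -/
theorem norm_le_hardyNorm {r : ℝ} {φ : ℂ × ℂ → ℂ} (hφ : MemHardy r φ) {z : ℂ × ℂ}
    (hz : z ∈ bernstein r) : ‖φ z‖ ≤ hardyNorm r φ := by
  obtain ⟨C, hC⟩ := (isBounded_bernstein r).isCompact_closure.exists_bound_of_continuousOn
    hφ.continuousOn
  exact le_ciSup (f := fun z : bernstein r => ‖φ z‖)
    ⟨C, by rintro _ ⟨w, rfl⟩; exact hC _ (subset_closure w.2)⟩ ⟨z, hz⟩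

/-! ### Partial fractions of f_n in the variable n. -/

theorem rot_eq (σ : ℤˣ) : rot σ = -1 / 2 + ((σ : ℤ) : ℂ) * ((√3 : ℝ) / 2) * Complex.I := by
  have h1 : 2 * Real.pi / 3 = Real.pi - Real.pi / 3 := by ring
  have hc : Real.cos (2 * Real.pi / 3) = -1 / 2 := by
    rw [h1, Real.cos_pi_sub, Real.cos_pi_div_three]; ring
  have hs : Real.sin (2 * Real.pi / 3) = √3 / 2 := by
    rw [h1, Real.sin_pi_sub, Real.sin_pi_div_three]
  have hexp : Complex.exp (((2 * Real.pi / 3 : ℝ) : ℂ) * Complex.I) =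
      -1 / 2 + ((√3 : ℝ) / 2) * Complex.I := by
    rw [Complex.exp_mul_I, ← Complex.ofReal_cos, ← Complex.ofReal_sin, hc, hs]
    push_cast
    ring
  have hexp' : Complex.exp (((-(2 * Real.pi / 3) : ℝ) : ℂ) * Complex.I) =
      -1 / 2 - ((√3 : ℝ) / 2) * Complex.I := by
    rw [Complex.exp_mul_I, ← Complex.ofReal_cos, ← Complex.ofReal_sin, Real.cos_neg, Real.sin_neg,
      hc, hs]
    push_cast
    ring
  rcases Int.units_eq_one_or σ with rfl | rfl
  · rw [rot, ← sub_eq_zero]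
    convert sub_eq_zero.2 hexp using 2
    · congr 1; push_cast; ring
    · push_cast; ring
  · rw [rot, ← sub_eq_zero]
    convert sub_eq_zero.2 hexp' using 2
    · congr 1; push_cast; ring
    · push_cast; ring

theorem units_sq (σ : ℤˣ) : (((σ : ℤ) : ℂ)) ^ 2 = 1 := by
  rcases Int.units_eq_one_or σ with rfl | rfl <;> norm_num

theorem norm_rot (σ : ℤˣ) : ‖rot σ‖ = 1 := by
  have : (2 * Real.pi * Complex.I / 3 * ((σ : ℤ) : ℂ)) =
      ((2 * Real.pi / 3 * (σ : ℤ) : ℝ) : ℂ) * Complex.I := by push_cast; ring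
  rw [rot, this, Complex.norm_exp_ofReal_mul_I]

/-- The coefficient of `n (1 - w)` in the denominator of `f_n(w)`. -/
noncomputable def kap (σ : ℤˣ) : ℂ := (√3 : ℝ) + 1 - rot σ

theorem eleven_le_norm_kap_sq (σ : ℤˣ) : 11 ≤ ‖kap σ‖ ^ 2 := by
  have h : kap σ = ((√3 + 3 / 2 : ℝ) : ℂ) - ((σ : ℤ) * (√3 / 2) : ℝ) * Complex.I := by
    rw [kap, rot_eq]; push_cast; ring
  have hσ : ((σ : ℤ) : ℝ) ^ 2 = 1 := by
    rcases Int.units_eq_one_or σ with rfl | rfl <;> norm_num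
  have h3 : √3 ^ 2 = 3 := Real.sq_sqrt (by norm_num)
  have h4 : 1.7 ≤ √3 := Real.le_sqrt_of_sq_le (by norm_num)
  rw [← Complex.normSq_eq_norm_sq, Complex.normSq_apply, h]
  simp only [Complex.sub_re, Complex.sub_im, Complex.mul_re, Complex.mul_im, Complex.ofReal_re,
      Complex.ofReal_im, Complex.I_re, Complex.I_im]
  have h5 : (((σ : ℤ) : ℝ) * (√3 / 2)) ^ 2 = 3 / 4 := by rw [mul_pow, hσ, div_pow, h3]; norm_num
  nlinarith

theorem three_le_norm_kap (σ : ℤˣ) : 3 ≤ ‖kap σ‖ := by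
  nlinarith [eleven_le_norm_kap_sq σ, norm_nonneg (kap σ)]

theorem kap_ne_zero (σ : ℤˣ) : kap σ ≠ 0 := by
  intro h; have := three_le_norm_kap σ; rw [h, norm_zero] at this; linarith

/-- The limit of `f_n` as `n → ∞`. -/
noncomputable def fLim (σ : ℤˣ) : ℂ :=
  ((1 - √3 / 2 : ℝ) : ℂ) + ((((σ : ℤ) : ℝ) * (√3 - 3 / 2) : ℝ) : ℂ) * Complex.I

theorem fLim_mul_kap (σ : ℤˣ) : fLim σ * kap σ = ((√3 : ℝ) - 1) * rot σ + 1 := by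
  rw [kap, rot_eq, fLim]
  have h1 := units_sq σ
  have h2 := sqrt_three_sq
  have h3 := Complex.I_sq
  push_cast
  generalize ((√3 : ℝ) : ℂ) = q at *
  generalize (((σ : ℤ)) : ℂ) = e at *
  linear_combination (-((q - 3 / 2) * q / 2) * Complex.I ^ 2) * h1 - ((q - 3 / 2) * q / 2) * h3 +
    (3 / 4 * e * Complex.I) * h2

/-- The pole of `f_n(w)` as a function of `n` is `-pole σ w`. -/
noncomputable def pole (σ : ℤˣ) (w : ℂ) : ℂ :=
  (√3 : ℝ) * ((√3 : ℝ) + 1 - rot σ * w) / ((1 - w) * kap σ)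

theorem den_eq (σ : ℤˣ) (n : ℂ) {w : ℂ} (hw : 1 - w ≠ 0) :
    den σ n w = kap σ * (1 - w) * (n + pole σ w) := by
  have hk := kap_ne_zero σ
  rw [pole, den]
  field_simp
  rw [kap]
  ring

/-- The residue of `f_n(w)` as a function of `n`. -/
noncomputable def res (σ : ℤˣ) : ℂ := -(3 * (√3 : ℝ) * rot σ / kap σ ^ 2)

/-- Numerator and denominator are affine in n. The residue is independent of w, so w enters only
through the pole. -/
theorem f_eq (σ : ℤˣ) {n w : ℂ} (hw : 1 - w ≠ 0) (hn : n + pole σ w ≠ 0) :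
    f σ n w = fLim σ + res σ / (n + pole σ w) := by
  have hk := kap_ne_zero σ
  have hfl : fLim σ = (((√3 : ℝ) - 1) * rot σ + 1) / kap σ := by
    rw [← fLim_mul_kap, mul_div_cancel_right₀ _ hk]
  have hp : pole σ w * ((1 - w) * kap σ) = (√3 : ℝ) * ((√3 : ℝ) + 1 - rot σ * w) := by
    rw [pole, div_mul_cancel₀ _ (mul_ne_zero hw hk)]
  rw [f, den_eq σ n hw, hfl, res, div_eq_iff (mul_ne_zero (mul_ne_zero hk hw) hn)]
  refine mul_left_cancel₀ hk ?_
  have hR : kap σ * (((((√3 : ℝ) - 1) * rot σ + 1) / kap σ +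
      -(3 * (√3 : ℝ) * rot σ / kap σ ^ 2) / (n + pole σ w)) *
        (kap σ * (1 - w) * (n + pole σ w))) =
      (((√3 : ℝ) - 1) * rot σ + 1) * (n * ((1 - w) * kap σ) + pole σ w * ((1 - w) * kap σ)) -
        3 * (√3 : ℝ) * rot σ * (1 - w) := by
    field_simp
    ring
  rw [hR, hp, num, kap]
  linear_combination ((√3 : ℝ) * rot σ * (w - 1)) * sqrt_three_sq

theorem norm_res_le (σ : ℤˣ) : ‖res σ‖ ≤ 1 / 2 := by
  have h1 := eleven_le_norm_kap_sq σ
  have h2 : √3 ≤ 1.75 := Real.sqrt_le_iff.2 ⟨by norm_num, by norm_num⟩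
  rw [res, norm_neg, norm_div, norm_mul, norm_mul, norm_rot, norm_pow, Complex.norm_real,
    Real.norm_of_nonneg (Real.sqrt_nonneg 3), div_le_iff₀ (by linarith)]
  norm_num
  linarith

/-! ### The branches at a point of the real square. -/

section RealPoint

variable (x y : ℝ)

/-- The point `x + iy` after rescaling. -/
noncomputable def wpt : ℂ := wPlus ((x : ℂ), (y : ℂ))

theorem wMinus_eq : wMinus ((x : ℂ), (y : ℂ)) = conj (wpt x y) := by
  have h4 : (starRingEnd ℂ) 4 = 4 := map_ofNat _ 4
  simp [wpt, wMinus, wPlus, h4, Complex.conj_ofReal, sub_eq_add_neg]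

variable {x y}

theorem wpt_eq : wpt x y = (((x + 1) / 4 : ℝ) : ℂ) + ((y / 4 : ℝ) : ℂ) * Complex.I := by
  rw [wpt, wPlus]; push_cast; ring

theorem norm_wpt_le (hx : x ∈ Set.Icc (-1 : ℝ) 1) (hy : y ∈ Set.Icc (-1 : ℝ) 1) :
    ‖wpt x y‖ ≤ 1 := by
  rw [wpt_eq]
  refine (norm_add_le _ _).trans ?_
  rw [norm_mul, Complex.norm_I, Complex.norm_real, Complex.norm_real, Real.norm_eq_abs,
    Real.norm_eq_abs, mul_one]
  have h1 : |(x + 1) / 4| ≤ 1 / 2 := abs_le.2 ⟨by linarith [hx.1], by linarith [hx.2]⟩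
  have h2 : |y / 4| ≤ 1 / 2 := abs_le.2 ⟨by linarith [hy.1], by linarith [hy.2]⟩
  linarith

theorem half_le_norm_one_sub_wpt (hx : x ∈ Set.Icc (-1 : ℝ) 1) : 1 / 2 ≤ ‖1 - wpt x y‖ := by
  refine le_trans ?_ (Complex.re_le_norm _)
  rw [wpt_eq]
  simp
  linarith [hx.2]

theorem one_sub_wpt_ne_zero (hx : x ∈ Set.Icc (-1 : ℝ) 1) : 1 - wpt x y ≠ 0 := by
  intro h
  have := half_le_norm_one_sub_wpt (y := y) hx
  rw [h, norm_zero] at this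
  linarith

theorem norm_pole_le (σ : ℤˣ) (hx : x ∈ Set.Icc (-1 : ℝ) 1) (hy : y ∈ Set.Icc (-1 : ℝ) 1) :
    ‖pole σ (wpt x y)‖ ≤ 5 := by
  have h1 := norm_wpt_le hx hy
  have h2 := half_le_norm_one_sub_wpt (y := y) hx
  have h3 := three_le_norm_kap σ
  have h4 : √3 ≤ 1.75 := Real.sqrt_le_iff.2 ⟨by norm_num, by norm_num⟩
  have h5 : ‖((√3 : ℝ) : ℂ) + 1 - rot σ * wpt x y‖ ≤ √3 + 2 := by
    refine (norm_sub_le _ _).trans ?_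
    have h6 := norm_add_le ((√3 : ℝ) : ℂ) 1
    rw [Complex.norm_real, Real.norm_of_nonneg (Real.sqrt_nonneg 3), norm_one] at h6
    rw [norm_mul, norm_rot, one_mul]
    linarith
  have h6 : 3 / 2 ≤ ‖1 - wpt x y‖ * ‖kap σ‖ := by nlinarith
  rw [pole, norm_div, norm_mul, norm_mul, Complex.norm_real,
    Real.norm_of_nonneg (Real.sqrt_nonneg 3), div_le_iff₀ (by linarith)]
  nlinarith [Real.sqrt_nonneg 3]

/-- The map `u ↦ G_{1/u}` at a real point. -/
noncomputable def gPath (σ : ℤˣ) (w u : ℂ) : ℂ × ℂ :=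
  (4 * (((fLim σ + res σ * u / (1 + pole σ w * u)) +
      (conj (fLim σ) + conj (res σ) * u / (1 + conj (pole σ w) * u))) / 2) - 1,
   4 * (((fLim σ + res σ * u / (1 + pole σ w * u)) -
      (conj (fLim σ) + conj (res σ) * u / (1 + conj (pole σ w) * u))) / (2 * Complex.I)))

theorem add_ne_zero_of_norm {n p : ℂ} (hp : ‖p‖ ≤ 5) (hn : 24 < ‖n‖) : n + p ≠ 0 := by
  intro h
  rw [eq_neg_of_add_eq_zero_left h, norm_neg] at hn
  linarith

theorem G_eq_gPath (σ : ℤˣ) (hx : x ∈ Set.Icc (-1 : ℝ) 1) (hy : y ∈ Set.Icc (-1 : ℝ) 1) {n : ℂ}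
    (hn : 24 < ‖n‖) : G σ n ((x : ℂ), (y : ℂ)) = gPath σ (wpt x y) n⁻¹ := by
  have hw := one_sub_wpt_ne_zero (y := y) hx
  have hn0 : n ≠ 0 := by rintro rfl; norm_num at hn
  have hp := norm_pole_le σ hx hy
  have h1 := add_ne_zero_of_norm hp hn
  have h2 : conj n + pole σ (wpt x y) ≠ 0 :=
    add_ne_zero_of_norm hp (by rwa [Complex.norm_conj])
  have h3 : ∀ r p : ℂ, r / (n + p) = r * n⁻¹ / (1 + p * n⁻¹) := fun r p => by
    rw [← div_eq_mul_inv, div_div]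
    congr 1
    field_simp
  have hf : f σ n (wpt x y) = fLim σ + res σ * n⁻¹ / (1 + pole σ (wpt x y) * n⁻¹) := by
    rw [f_eq σ hw h1, h3]
  have hfb : fBar σ n (conj (wpt x y)) =
      conj (fLim σ) + conj (res σ) * n⁻¹ / (1 + conj (pole σ (wpt x y)) * n⁻¹) := by
    rw [fBar, Complex.conj_conj, f_eq σ hw h2, ← h3]
    simp
  rw [G, wMinus_eq, show wPlus ((x : ℂ), (y : ℂ)) = wpt x y from rfl, hf, hfb, gPath]

/-- The numerator is at most 1/48 and the denominator at least 19/24. -/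
theorem norm_res_mul_le {r p u : ℂ} (hr : ‖r‖ ≤ 1 / 2) (hp : ‖p‖ ≤ 5) (hu : ‖u‖ < 1 / 24) :
    ‖r * u / (1 + p * u)‖ ≤ 1 / 38 := by
  have h1 := (BranchData.re_one_add_pos hp hu).trans (Complex.re_le_norm _)
  rw [norm_div, norm_mul, div_le_iff₀ (by linarith)]
  nlinarith [norm_nonneg r, norm_nonneg u]

/-- The rescaled limit (3 - 2√3, ±(4√3 - 6)) lies in the square, and each coordinate moves by at
most 2 (1/38 + 1/38) = 2/19 < 1/9. -/
theorem gPath_mem (σ : ℤˣ) (hx : x ∈ Set.Icc (-1 : ℝ) 1) (hy : y ∈ Set.Icc (-1 : ℝ) 1) {u : ℂ}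
    (hu : ‖u‖ < 1 / 24) : gPath σ (wpt x y) u ∈ bernstein rA := by
  have hp := norm_pole_le σ hx hy
  have hA := norm_res_mul_le (norm_res_le σ) hp hu
  have hB := norm_res_mul_le (r := conj (res σ)) (p := conj (pole σ (wpt x y))) (u := u)
    (by rw [Complex.norm_conj]; exact norm_res_le σ) (by rwa [Complex.norm_conj]) hu
  rw [gPath]
  set A := res σ * u / (1 + pole σ (wpt x y) * u)
  set B := conj (res σ) * u / (1 + conj (pole σ (wpt x y)) * u)
  have h3 : √3 ^ 2 = 3 := Real.sq_sqrt (by norm_num)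
  have h4 : 1.7 ≤ √3 := Real.le_sqrt_of_sq_le (by norm_num)
  have h5 : √3 ≤ 1.75 := Real.sqrt_le_iff.2 ⟨by norm_num, by norm_num⟩
  have hc : conj (fLim σ) = ((1 - √3 / 2 : ℝ) : ℂ) -
      ((((σ : ℤ) : ℝ) * (√3 - 3 / 2) : ℝ) : ℂ) * Complex.I := by
    rw [fLim, map_add, map_mul, Complex.conj_I, Complex.conj_ofReal, Complex.conj_ofReal]
    ring
  refine mem_bernstein_of_norm_sub_le (x := 4 * (1 - √3 / 2) - 1)
    (y := 4 * (((σ : ℤ) : ℝ) * (√3 - 3 / 2))) ⟨by linarith, by linarith⟩ ?_ ?_ ?_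
  · rcases Int.units_eq_one_or σ with rfl | rfl
    · constructor <;> push_cast <;> linarith
    · constructor <;> push_cast <;> linarith
  · have : 4 * ((fLim σ + A + (conj (fLim σ) + B)) / 2) - 1 -
        ((4 * (1 - √3 / 2) - 1 : ℝ) : ℂ) = 2 * (A + B) := by
      rw [hc, fLim]; push_cast; ring
    simp only [this]
    rw [norm_mul, Complex.norm_two]
    linarith [norm_add_le A B]
  · have : 4 * ((fLim σ + A - (conj (fLim σ) + B)) / (2 * Complex.I)) -
        ((4 * (((σ : ℤ) : ℝ) * (√3 - 3 / 2)) : ℝ) : ℂ) = 2 * (A - B) * (-Complex.I) := by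
      rw [hc, fLim, div_eq_mul_inv, mul_inv, Complex.inv_I]
      push_cast
      linear_combination (-4 * (σ : ℤ) * ((√3 : ℝ) - 3 / 2) : ℂ) * Complex.I_sq
    simp only [this]
    rw [norm_mul, norm_mul, norm_neg, Complex.norm_I, Complex.norm_two]
    linarith [norm_sub_le A B]

theorem differentiableAt_gPath (σ : ℤˣ) (hx : x ∈ Set.Icc (-1 : ℝ) 1)
    (hy : y ∈ Set.Icc (-1 : ℝ) 1) {u : ℂ} (hu : ‖u‖ < 1 / 24) :
    DifferentiableAt ℂ (gPath σ (wpt x y)) u := by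
  have hp := norm_pole_le σ hx hy
  have hne : ∀ p : ℂ, ‖p‖ ≤ 5 → 1 + p * u ≠ 0 := fun p hp h => by
    have := BranchData.re_one_add_pos hp hu
    rw [h, Complex.zero_re] at this
    linarith
  have h1 := hne _ hp
  have h2 := hne (conj (pole σ (wpt x y))) (by rwa [Complex.norm_conj])
  unfold gPath
  fun_prop (disch := assumption)

/-- The branch data of the sign `σ` at a real point of the square. -/
noncomputable def branch (σ : ℤˣ) {φ : ℂ × ℂ → ℂ} (hφ : MemHardy rA φ)
    (hx : x ∈ Set.Icc (-1 : ℝ) 1) (hy : y ∈ Set.Icc (-1 : ℝ) 1) : BranchData where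
  p := pole σ (wpt x y)
  c := 9 / (‖kap σ‖ ^ 2 * ‖1 - wpt x y‖ ^ 2)
  B := hardyNorm rA φ
  Φ := fun u => φ (gPath σ (wpt x y) u)
  norm_p := norm_pole_le σ hx hy
  c_pos := by
    have h1 := eleven_le_norm_kap_sq σ
    have h2 := half_le_norm_one_sub_wpt (y := y) hx
    exact div_pos (by norm_num) (mul_pos (by linarith) (by nlinarith))
  c_le := by
    have h1 := eleven_le_norm_kap_sq σ
    have h2 := half_le_norm_one_sub_wpt (y := y) hx
    have h3 : 1 / 4 ≤ ‖1 - wpt x y‖ ^ 2 := by nlinarith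
    rw [div_le_iff₀ (mul_pos (by linarith) (by linarith))]
    nlinarith
  diff := fun u hu => by
    have hu' := mem_ball_zero_iff.1 hu
    exact ((hφ.analytic _ (gPath_mem σ hx hy hu')).differentiableAt.comp u
      (differentiableAt_gPath σ hx hy hu')).differentiableWithinAt
  bound := fun u hu => norm_le_hardyNorm hφ (gPath_mem σ hx hy (mem_ball_zero_iff.1 hu))

theorem J_eq_jac (σ : ℤˣ) {φ : ℂ × ℂ → ℂ} (hφ : MemHardy rA φ)
    (hx : x ∈ Set.Icc (-1 : ℝ) 1) (hy : y ∈ Set.Icc (-1 : ℝ) 1) (n : ℂ) :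
    J σ n ((x : ℂ), (y : ℂ)) = (branch σ hφ hx hy).jac n := by
  have hw := one_sub_wpt_ne_zero (y := y) hx
  rw [J, wMinus_eq, Complex.conj_conj, show wPlus ((x : ℂ), (y : ℂ)) = wpt x y from rfl,
    den_eq σ n hw, den_eq σ _ hw, BranchData.jac]
  have h : kap σ * (1 - wpt x y) * (n + pole σ (wpt x y)) *
      conj (kap σ * (1 - wpt x y) * (conj n + pole σ (wpt x y))) =
      ((‖kap σ‖ ^ 2 * ‖1 - wpt x y‖ ^ 2 : ℝ) : ℂ) *
        ((n + pole σ (wpt x y)) * (n + conj (pole σ (wpt x y)))) := by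
    push_cast
    rw [← Complex.mul_conj' (kap σ), ← Complex.mul_conj' (1 - wpt x y)]
    simp only [map_mul, map_add, Complex.conj_conj]
    ring
  rw [h, ← div_div]
  simp only [branch]
  push_cast
  rfl

theorem summand_eq_h (σ : ℤˣ) {φ : ℂ × ℂ → ℂ} (hφ : MemHardy rA φ) (s : ℝ)
    (hx : x ∈ Set.Icc (-1 : ℝ) 1) (hy : y ∈ Set.Icc (-1 : ℝ) 1) {n : ℂ} (hn : 24 < ‖n‖) :
    J σ n ((x : ℂ), (y : ℂ)) ^ (s : ℂ) * φ (G σ n ((x : ℂ), (y : ℂ))) =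
      (branch σ hφ hx hy).h s n := by
  rw [J_eq_jac σ hφ hx hy, G_eq_gPath σ hx hy hn]
  rfl

/-- The factor n² makes the base of the power a holomorphic function of 1/n that avoids the cut on
the whole exterior |n| > 24, so nodes all around the origin are allowed. -/
theorem summand_eq_g (σ : ℤˣ) {φ : ℂ × ℂ → ℂ} (hφ : MemHardy rA φ) (s : ℝ)
    (hx : x ∈ Set.Icc (-1 : ℝ) 1) (hy : y ∈ Set.Icc (-1 : ℝ) 1) {n : ℂ} (hn : 24 < ‖n‖) :
    (n ^ 2 * J σ n ((x : ℂ), (y : ℂ))) ^ (s : ℂ) * φ (G σ n ((x : ℂ), (y : ℂ))) =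
      (branch σ hφ hx hy).g s n⁻¹ := by
  have hn0 : n ≠ 0 := by rintro rfl; norm_num at hn
  rw [J_eq_jac σ hφ hx hy, G_eq_gPath σ hx hy hn, BranchData.jac_eq _ hn0]
  rfl

end RealPoint

/-! ### Error for one sign, and the choice of parameters. -/

theorem norm_derivNode {L N M : ℕ} (hL : 1 ≤ L) (hN : N = 10 + 64 * L) (m : ℕ) :
    24 < ‖derivNode N M m‖ := by
  have hLr : (1 : ℝ) ≤ L := by exact_mod_cast hL
  have hNr : (N : ℝ) = 10 + 64 * L := by rw [hN]; push_cast; ring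
  have he2 : 2 < Real.exp 1 := by linarith [Real.exp_one_gt_d9]
  have htau : tau N = 64 * L / Real.exp 1 := by rw [tau, nuA, hNr]; ring
  have htau0 : 0 ≤ tau N := by rw [htau]; positivity
  have htau1 : tau N ≤ 32 * L := by
    rw [htau, div_le_iff₀ (by linarith)]; nlinarith
  have hexp : (2 * Real.pi * Complex.I * ((2 * m - 1) / (2 * M)) : ℂ) =
      ((2 * Real.pi * ((2 * m - 1) / (2 * M)) : ℝ) : ℂ) * Complex.I := by push_cast; ring
  have h1 := norm_sub_le (derivNode N M m)
    (tau N * Complex.exp (2 * Real.pi * Complex.I * ((2 * m - 1) / (2 * M))))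
  rw [derivNode, add_sub_cancel_right, norm_mul, hexp, Complex.norm_exp_ofReal_mul_I,
    Complex.norm_natCast, Complex.norm_real, Real.norm_of_nonneg htau0] at h1
  rw [derivNode, hexp]
  linarith

/-- The error estimate for a single sign and fixed parameters. -/
theorem norm_sign_error_le (σ : ℤˣ) {φ : ℂ × ℂ → ℂ} (hφ : MemHardy rA φ) {s : ℝ} (hs : 1 / 2 < s)
    {x y : ℝ} (hx : x ∈ Set.Icc (-1 : ℝ) 1) (hy : y ∈ Set.Icc (-1 : ℝ) 1)
    {L N M M' : ℕ} (hL : 1 ≤ L) (hN : N = 10 + 64 * L)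
    (hM : M = 8 * L) (hM' : M' = 4 * L) {R : ℝ} (hR : N ≤ R)
    (hRs : (25 / (N : ℝ)) ^ (M' - 1) * (25 / R) ≤ (2 * s - 1) * (1 / 8) ^ L) :
    (Summable fun n : ℕ => J σ n ((x : ℂ), (y : ℂ)) ^ (s : ℂ) * φ (G σ n ((x : ℂ), (y : ℂ)))) ∧
    ‖∑' n : ℕ, J σ n ((x : ℂ), (y : ℂ)) ^ (s : ℂ) * φ (G σ n ((x : ℂ), (y : ℂ))) -
      (∑ n ∈ Finset.range N, J σ n ((x : ℂ), (y : ℂ)) ^ (s : ℂ) * φ (G σ n ((x : ℂ), (y : ℂ)))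
        + 1 / 2 * (J σ N ((x : ℂ), (y : ℂ)) ^ (s : ℂ) * φ (G σ N ((x : ℂ), (y : ℂ))))
        + 1 / (M : ℂ) * ∑ m ∈ Finset.Icc 1 M, derivWeight N L M m *
            J σ (derivNode N M m) ((x : ℂ), (y : ℂ)) ^ (s : ℂ) *
            φ (G σ (derivNode N M m) ((x : ℂ), (y : ℂ)))
        + 1 / (M' : ℂ) * ∑ m ∈ Finset.range M', circWeight s N R M' m *
            (circNode R M' m ^ 2 * J σ (circNode R M' m) ((x : ℂ), (y : ℂ))) ^ (s : ℂ) *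
            φ (G σ (circNode R M' m) ((x : ℂ), (y : ℂ))))‖ ≤
      302 * (7 ^ s * hardyNorm rA φ) * (1 / 2) ^ L := by
  have hLr : (1 : ℝ) ≤ L := by exact_mod_cast hL
  have hNr : (N : ℝ) = 10 + 64 * L := by rw [hN]; push_cast; ring
  set T : ℕ → ℂ := fun n => J σ n ((x : ℂ), (y : ℂ)) ^ (s : ℂ) * φ (G σ n ((x : ℂ), (y : ℂ)))
    with hT
  set D := branch σ hφ hx hy with hD
  have hTh : ∀ n : ℕ, 24 < n → T n = D.h s n := fun n hn =>
    summand_eq_h σ hφ s hx hy (by rw [Complex.norm_natCast]; exact_mod_cast hn)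
  have hTi : ∀ i : ℕ, T (i + N) = D.h s (N + i : ℕ) := fun i => by
    rw [hTh _ (by omega), add_comm]
  have hsum : Summable T := by
    rw [← summable_nat_add_iff N]
    have h1 := (summable_nat_add_iff N).2 (D.summable_h hs)
    refine h1.congr fun i => ?_
    rw [hTi, add_comm]
  refine ⟨hsum, ?_⟩
  have hd : ∀ m, derivWeight N L M m * J σ (derivNode N M m) ((x : ℂ), (y : ℂ)) ^ (s : ℂ) *
      φ (G σ (derivNode N M m) ((x : ℂ), (y : ℂ))) =
      derivWeight N L M m * D.h s (derivNode N M m) := fun m => by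
    rw [mul_assoc, summand_eq_h σ hφ s hx hy (norm_derivNode hL hN m)]
  have hc : ∀ m, circWeight s N R M' m *
      (circNode R M' m ^ 2 * J σ (circNode R M' m) ((x : ℂ), (y : ℂ))) ^ (s : ℂ) *
      φ (G σ (circNode R M' m) ((x : ℂ), (y : ℂ))) =
      circWeight s N R M' m * D.g s (circNode R M' m)⁻¹ := fun m => by
    rw [mul_assoc, summand_eq_g σ hφ s hx hy (by rw [norm_circNode (by linarith)]; linarith)]
  have hTN : J σ N ((x : ℂ), (y : ℂ)) ^ (s : ℂ) * φ (G σ N ((x : ℂ), (y : ℂ))) = D.h s N :=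
    hTh N (by omega)
  simp only [hd, hc, hTN]
  rw [← hsum.sum_add_tsum_nat_add N, tsum_congr hTi]
  refine le_trans (le_of_eq ?_) (D.norm_branch_le hs hL hN hM hM' hR hRs)
  congr 1
  ring

/-- The order of the Euler-Maclaurin expansion that is used for the accuracy `ε`. -/
noncomputable def order (ε : ℝ) : ℕ := ⌈2 * |Real.log (min ε (1 / 2))|⌉₊

theorem log_two_le_abs_log {ε : ℝ} (hε : 0 < ε) : Real.log 2 ≤ -Real.log (min ε (1 / 2)) := by
  have h1 := Real.log_le_log (lt_min hε (by norm_num)) (min_le_right ε (1 / 2))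
  rw [one_div, Real.log_inv] at h1
  linarith

theorem one_le_order {ε : ℝ} (hε : 0 < ε) : 1 ≤ order ε := by
  rw [order, Nat.one_le_ceil_iff]
  have h1 := log_two_le_abs_log hε
  have h2 := neg_le_abs (Real.log (min ε (1 / 2)))
  linarith [Real.log_two_gt_d9]

/-- The factor 2 in `order` compensates for the base: 2 log 2 > 1. -/
theorem half_pow_order_le {ε : ℝ} (hε : 0 < ε) : (1 / 2 : ℝ) ^ order ε ≤ min ε (1 / 2) := by
  have hδ : 0 < min ε (1 / 2) := lt_min hε (by norm_num)
  rw [← Real.log_le_log_iff (by positivity) hδ, Real.log_pow, one_div, Real.log_inv]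
  have h1 := Nat.le_ceil (2 * |Real.log (min ε (1 / 2))|)
  have h2 := neg_le_abs (Real.log (min ε (1 / 2)))
  have h3 := log_two_le_abs_log hε
  have h4 := Real.log_two_gt_d9
  change _ ≤ (order ε : ℝ) at h1
  rw [one_div] at *
  nlinarith

theorem order_isBigO : (fun ε => (order ε : ℝ)) =O[𝓝[>] 0] Real.log := by
  refine IsBigO.of_bound 4 ?_
  filter_upwards [Ioo_mem_nhdsGT (show (0 : ℝ) < 1 / 2 by norm_num)] with ε hε
  have h1 := log_two_le_abs_log hε.1
  have h2 := Nat.ceil_lt_add_one (a := 2 * |Real.log (min ε (1 / 2))|) (by positivity)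
  change (order ε : ℝ) < _ at h2
  rw [min_eq_left hε.2.le] at h1 h2
  have h3 := neg_le_abs (Real.log ε)
  have h4 := Real.log_two_gt_d9
  rw [Real.norm_natCast, Real.norm_eq_abs]
  linarith

theorem isBigO_affine_order (a b : ℕ) :
    (fun ε => ((a + b * order ε : ℕ) : ℝ)) =O[𝓝[>] 0] Real.log := by
  refine IsBigO.trans (IsBigO.of_bound ((a + b : ℕ) : ℝ) ?_) order_isBigO
  filter_upwards [self_mem_nhdsWithin] with ε hε
  rw [Real.norm_natCast, Real.norm_natCast]
  have h1 := one_le_order hε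
  exact_mod_cast (by nlinarith : a + b * order ε ≤ (a + b) * order ε)

/-- The radius of the quadrature circle: `N` when `2 s - 1` is not too small. -/
theorem exists_radius {s δ : ℝ} (hs : 1 / 2 < s) {L N M' : ℕ} (hN : N = 10 + 64 * L) (hL : 1 ≤ L)
    (hM' : M' = 4 * L) (hδ : (1 / 2 : ℝ) ^ L ≤ δ) :
    ∃ R : ℝ, N ≤ R ∧ (δ ≤ 2 * s - 1 → R = N) ∧
      (25 / (N : ℝ)) ^ (M' - 1) * (25 / R) ≤ (2 * s - 1) * (1 / 8) ^ L := by
  have hLr : (1 : ℝ) ≤ L := by exact_mod_cast hL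
  have hNr : (N : ℝ) = 10 + 64 * L := by rw [hN]; push_cast; ring
  have hs1 : 0 < 2 * s - 1 := by linarith
  have hN2 : 25 / (N : ℝ) ≤ 1 / 2 := by
    rw [div_le_div_iff₀ (by linarith) (by norm_num)]; linarith
  have hN0 : 0 ≤ 25 / (N : ℝ) := by positivity
  -- With R = N the left side is (25 / N)^(4L) ≤ 2^(-L) · 8^(-L), and 2^(-L) ≤ δ ≤ 2s - 1.
  by_cases h : δ ≤ 2 * s - 1
  · refine ⟨N, le_rfl, fun _ => rfl, ?_⟩
    rw [← pow_succ, show M' - 1 + 1 = 4 * L by omega, pow_mul]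
    calc ((25 / (N : ℝ)) ^ 4) ^ L ≤ ((1 / 2) ^ 4) ^ L := by gcongr
      _ = (1 / 2) ^ L * (1 / 8) ^ L := by rw [← mul_pow]; norm_num
      _ ≤ _ := by
        gcongr
        exact hδ.trans h
  -- For s close to 1/2 the second entry is chosen so that 25 / R alone gives the bound.
  · refine ⟨max N (25 * 8 ^ L / (2 * s - 1)), le_max_left _ _, fun h' => absurd h' h, ?_⟩
    have h1 : 0 < 25 * 8 ^ L / (2 * s - 1) := by positivity
    have h2 : (25 / (N : ℝ)) ^ (M' - 1) ≤ 1 := pow_le_one₀ hN0 (by linarith)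
    calc (25 / (N : ℝ)) ^ (M' - 1) * (25 / max (N : ℝ) (25 * 8 ^ L / (2 * s - 1)))
        ≤ 1 * (25 / (25 * 8 ^ L / (2 * s - 1))) := by
          gcongr
          exact le_max_right _ _
      _ = _ := by
        rw [one_div, inv_pow]
        field_simp

end Apollonian

/-! ### The theorem. -/

open Apollonian in
theorem mainTheorem5 : ∃ CA : ℝ, 0 < CA ∧ ∃ N L M M' : ℝ → ℕ,
    (fun ε => (N ε : ℝ)) =O[𝓝[>] 0] Real.log ∧
    (fun ε => (L ε : ℝ)) =O[𝓝[>] 0] Real.log ∧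
    (fun ε => (M ε : ℝ)) =O[𝓝[>] 0] Real.log ∧
    (fun ε => (M' ε : ℝ)) =O[𝓝[>] 0] Real.log ∧
    ∀ ε : ℝ, 0 < ε →
      nuA < N ε ∧ 1 ≤ L ε ∧ 2 * L ε ≤ M ε ∧ 1 ≤ M' ε ∧
      2 * (L ε : ℝ) < 2 * Real.exp 1 * Real.pi * (N ε - nuA) ∧
      ∀ s : ℝ, 1 / 2 < s → ∃ c' z' : ℕ → ℂ,
        (∀ m < M' ε, (N ε : ℝ) ≤ ‖z' m‖) ∧
        (1 + ε ≤ 2 * s → ∀ m < M' ε,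
          z' m = integralNode (N ε) (M' ε) m ∧ c' m = integralWeight s (N ε) (M' ε) m) ∧
        ∀ φ : ℂ × ℂ → ℂ, MemHardy rA φ →
          ∀ x ∈ Set.Icc (-1 : ℝ) 1, ∀ y ∈ Set.Icc (-1 : ℝ) 1,
            Summable (fun n : ℕ => transferTerm s φ ((x : ℂ), (y : ℂ)) n) ∧
            ‖transferOp s φ ((x : ℂ), (y : ℂ)) -
              ∑ σ : ℤˣ,
                (∑ n ∈ Finset.range (N ε),
                    J σ n ((x : ℂ), (y : ℂ)) ^ (s : ℂ) * φ (G σ n ((x : ℂ), (y : ℂ)))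
                  + 1 / 2 * (J σ (N ε) ((x : ℂ), (y : ℂ)) ^ (s : ℂ) *
                      φ (G σ (N ε) ((x : ℂ), (y : ℂ))))
                  + 1 / (M ε : ℂ) * ∑ m ∈ Finset.Icc 1 (M ε),
                      derivWeight (N ε) (L ε) (M ε) m *
                        J σ (derivNode (N ε) (M ε) m) ((x : ℂ), (y : ℂ)) ^ (s : ℂ) *
                        φ (G σ (derivNode (N ε) (M ε) m) ((x : ℂ), (y : ℂ)))
                  + 1 / (M' ε : ℂ) * ∑ m ∈ Finset.range (M' ε),
                      c' m * (z' m ^ 2 * J σ (z' m) ((x : ℂ), (y : ℂ))) ^ (s : ℂ) *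
                        φ (G σ (z' m) ((x : ℂ), (y : ℂ))))‖
              ≤ hardyNorm rA φ * CA ^ s * ε := by
  refine ⟨7 * 604 ^ 2, by norm_num, fun ε => 10 + 64 * order ε, order, fun ε => 8 * order ε,
    fun ε => 4 * order ε, isBigO_affine_order 10 64, order_isBigO, ?_, ?_, ?_⟩
  · simpa only [zero_add] using isBigO_affine_order 0 8
  · simpa only [zero_add] using isBigO_affine_order 0 4
  intro ε hε
  have hL := one_le_order hε
  have hδ := half_pow_order_le hε
  set L := order ε with hLd
  have hLr : (1 : ℝ) ≤ L := by exact_mod_cast hL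
  dsimp only
  rw [← hLd]
  refine ⟨?_, hL, by omega, by omega, ?_, ?_⟩
  · rw [nuA]; push_cast; linarith
  · have h1 : 1 ≤ Real.exp 1 * Real.pi := by
      nlinarith [Real.exp_one_gt_d9, Real.pi_gt_three]
    rw [nuA]
    push_cast
    nlinarith
  intro s hs
  obtain ⟨R, hR, hRN, hRs⟩ := exists_radius hs rfl hL rfl hδ
  refine ⟨circWeight s (10 + 64 * L) R (4 * L), circNode R (4 * L), fun m _ => ?_,
    fun h m _ => ?_, fun φ hφ x hx y hy => ?_⟩
  · rw [norm_circNode ((Nat.cast_nonneg _).trans hR)]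
    exact hR
  -- The radius was chosen with δ = min ε (1/2) ≤ ε, so 2s - 1 ≥ ε forces R = N and the explicit
  -- nodes.
  · rw [hRN ((min_le_left _ _).trans (by linarith))]
    exact ⟨circNode_natCast _ _ _, circWeight_natCast (by omega) _ _⟩
  have key := fun σ : ℤˣ => norm_sign_error_le σ hφ hs hx hy hL rfl rfl rfl hR hRs
  refine ⟨summable_sum fun σ _ => (key σ).1, ?_⟩
  have htr : transferOp s φ ((x : ℂ), (y : ℂ)) = ∑ σ : ℤˣ, ∑' n : ℕ,
      J σ n ((x : ℂ), (y : ℂ)) ^ (s : ℂ) * φ (G σ n ((x : ℂ), (y : ℂ))) :=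
    Summable.tsum_finsetSum fun σ _ => (key σ).1
  rw [htr, ← Finset.sum_sub_distrib]
  refine (norm_sum_le_of_le _ fun σ _ => (key σ).2).trans ?_
  have hφ0 : 0 ≤ hardyNorm rA φ := (branch 1 hφ hx hy).B_nonneg
  have hcard : (Finset.univ : Finset ℤˣ).card = 2 := by decide
  -- Two signs give 2 · 302 = 604. As 2s > 1, this prefactor fits into an s-th power, whence C_A = 7
  -- · 604².
  have h604 : (604 : ℝ) ≤ (604 ^ 2) ^ s := by
    rw [← Real.rpow_natCast 604 2, ← Real.rpow_mul (by norm_num)]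
    refine Real.self_le_rpow_of_one_le (by norm_num) ?_
    push_cast
    linarith
  rw [Finset.sum_const, hcard, nsmul_eq_mul, Real.mul_rpow (by norm_num) (by norm_num)]
  calc ((2 : ℕ) : ℝ) * (302 * (7 ^ s * hardyNorm rA φ) * (1 / 2) ^ L)
      = hardyNorm rA φ * (7 ^ s * 604) * (1 / 2) ^ L := by push_cast; ring
    _ ≤ hardyNorm rA φ * (7 ^ s * (604 ^ 2) ^ s) * ε := by
      gcongr
      exact hδ.trans (min_le_left _ _)
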